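/- Let $A$ be a complex unital Banach algebra with unit $e$, let $J$ be a two-sided ideal of $A$ (not necessarily closed), let $\pi : A \to A/J$ be the canonical projection, and let $a \in A$. An element $x\in A$ is called a Fredholm element modulo $J$ if $\pi(x)$ is invertible in the ring $A/J$, and a B-Fredholm element modulo $J$ if $\pi(x)$ is Drazin invertible in $A/J$, that is, there are $b \in A/J$ and $k \in \mathbb{N}$ with $b\pi(x)b=b$, $\pi(x)b=b\pi(x)$ and $\pi(x)^k b\,\pi(x)=\pi(x)^k$. Put $$\sigma_F(x)=\{\lambda\in\mathbb{C} : x-\lambda e \text{ is not a Fredholm element modulo } J\},\qquad \sigma_{BF}(x)=\{\lambda\in\mathbb{C} : x-\lambda e \text{ is not a B-Fredholm element modulo } J\}.$$ Let $f$ be a complex function that is analytic in an open neighbourhood of the spectrum $\sigma(a)$ and that is not constant near any connected component of $\sigma(a)$, in the sense that for no connected component $C$ of $\sigma(a)$ is $f$ constant on an open set containing $C$ (this holds in particular if $f$ is non-constant on each connected component of $\sigma(a)$). Let $f(a)$ be given by the holomorphic functional calculus, $f(a)=\frac{1}{2\pi i}\oint f(z)(ze-a)^{-1}\,dz$, integrated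 over a contour surrounding $\sigma(a)$ in the domain of $f$. Then $$f(\sigma_{BF}(a))=\sigma_{BF}(f(a))\qquad\text{and}\qquad f(\sigma_{F}(a))=\sigma_{F}(f(a)).$$ -/

import Mathlib

open Set Filter Topology

noncomputable section

/-! ### Drazin invertible, Fredholm and B-Fredholm elements of a ring -/

/-- `a` is Drazin invertible in the ring `R`: there are `b` and `k` with
`b a b = b`, `a b = b a`, `a ^ k b a = a ^ k`. -/
def IsDrazinInvertible {R : Type*} [Ring R] (a : R) : Prop :=
  ∃ (b : R) (k : ℕ), b * a * b = b ∧ a * b = b * a ∧ a ^ k * b * a = a ^ k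

/-- `a` is a Fredholm element of `R` modulo the two-sided ideal `J`: its image in `R ⧸ J` is
invertible. -/
def IsFredholmElement {R : Type*} [Ring R] (J : Ideal R) [J.IsTwoSided] (a : R) : Prop :=
  IsUnit (Ideal.Quotient.mk J a)

/-- `a` is a B-Fredholm element of `R` modulo the two-sided ideal `J`: its image in `R ⧸ J` is
Drazin invertible. -/
def IsBFredholmElement {R : Type*} [Ring R] (J : Ideal R) [J.IsTwoSided] (a : R) : Prop :=
  IsDrazinInvertible (Ideal.Quotient.mk J a)

/-- The Fredholm spectrum of `a` modulo `J`. -/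
def fredholmSpectrum {A : Type*} [Ring A] [Algebra ℂ A] (J : Ideal A) [J.IsTwoSided] (a : A) :
    Set ℂ :=
  {z : ℂ | ¬ IsFredholmElement J (a - algebraMap ℂ A z)}

/-- The B-Fredholm spectrum of `a` modulo `J`. -/
def bFredholmSpectrum {A : Type*} [Ring A] [Algebra ℂ A] (J : Ideal A) [J.IsTwoSided] (a : A) :
    Set ℂ :=
  {z : ℂ | ¬ IsBFredholmElement J (a - algebraMap ℂ A z)}

/-! ### The holomorphic (Riesz) functional calculus

The contour surrounding a compact set `K` inside a neighbourhood of `K` is the classical one: take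
the mesh of closed squares of side `δ`, keep the squares that meet `K`, and take the positively
oriented boundary of their union.  An edge shared by two kept squares cancels, so that the
contour does not meet `K`; for small `δ` it lies in the given neighbourhood. -/

/-- The closed square `[m δ, (m + 1) δ] × [n δ, (n + 1) δ]` of the mesh of side `δ`. -/
def meshSquare (δ : ℝ) (m n : ℤ) : Set ℂ :=
  Icc (m * δ) ((m + 1) * δ) ×ℂ Icc (n * δ) ((n + 1) * δ)

open Classical in
/-- `1` if the square with indices `m, n` of the mesh of side `δ` meets `K`, and `0` otherwise. -/
def meshIndicator (K : Set ℂ) (δ : ℝ) (m n : ℤ) : ℤ :=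
  if (meshSquare δ m n ∩ K).Nonempty then 1 else 0

/-- `∮ F(z) dz` over the positively oriented boundary of the union of the squares of the mesh of
side `δ` that meet `K`.  The sum is over all edges of the mesh: the horizontal edge from
`(m δ, n δ)` to `((m + 1) δ, n δ)` is the bottom of the square `m, n` and the top of the square
`m, n - 1`, and the vertical edge from `(m δ, n δ)` to `(m δ, (n + 1) δ)` is the right side of the
square `m - 1, n` and the left side of the square `m, n`.  Edges that are not on the boundary have
coefficient `0`; for bounded `K` and `δ > 0` only finitely many edges have a non-zero
coefficient. -/
def meshContourIntegral {E : Type*} [NormedAddCommGroup E] [NormedSpace ℂ E]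
    (K : Set ℂ) (δ : ℝ) (F : ℂ → E) : E :=
  ∑ᶠ p : ℤ × ℤ,
    ((meshIndicator K δ p.1 p.2 - meshIndicator K δ p.1 (p.2 - 1)) •
        (∫ x : ℝ in (p.1 * δ)..((p.1 + 1) * δ), F (x + (p.2 * δ : ℝ) * Complex.I))
      + (meshIndicator K δ (p.1 - 1) p.2 - meshIndicator K δ p.1 p.2) •
        (Complex.I •
          ∫ y : ℝ in (p.2 * δ)..((p.2 + 1) * δ), F ((p.1 * δ : ℝ) + y * Complex.I)))

/-- `f(a) = (2 π i)⁻¹ ∮ f(z) (z - a)⁻¹ dz`, the integral being over the contour of mesh `δ` around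
the spectrum of `a`, for small `δ`.  When `f` is analytic in a neighbourhood of the spectrum, the
integral does not depend on `δ` once `δ > 0` is small enough, and the limit is that common
value. -/
def holomorphicCalculus {A : Type*} [NormedRing A] [NormedAlgebra ℂ A] (f : ℂ → ℂ) (a : A) : A :=
  limUnder (𝓝[>] (0 : ℝ)) fun δ : ℝ =>
    (2 * Real.pi * Complex.I : ℂ)⁻¹ •
      meshContourIntegral (spectrum ℂ a) δ fun z : ℂ => f z • resolvent a z

end

/-! ### Drazin invertibility in rings -/

section Drazin

variable {R : Type*} [Ring R]

/-! By the component hypothesis `f - μ` vanishes identically near no point of the compact set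
`σ(a)`, so it has finitely many zeros `z` there. Dividing them out, the functional calculus gives
`f(a) - μ = ∏ (a - z) ^ n z * u` with `u` a unit commuting with the product
(`exists_holomorphicCalculus_sub_eq`).

What remains is algebra in `A ⧸ J`, so `J` need not be closed. A commuting product is a unit iff
every factor is. For Drazin invertibility this fails in general, but here the factors are images of
pairwise coprime polynomials, and a Bezout identity recovers each factor
(`IsDrazinInvertible.of_map_mul`, `isDrazinInvertible_map_prod_pow_iff`). Points outside `σ(a)`
belong to neither spectrum, since there `a - z` is already a unit of `A`. Hence `μ` lies in a
spectrum of `f(a)` iff some `z` with `f z = μ` lies in that of `a`.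

The analytic work is to show that the mesh integrals do not depend on the mesh once it is fine, are
multiplicative, and send polynomials to polynomials in `a`. Multiplicativity (`meshCalculus_mul`)
rests on divided differences, Fubini and Cauchy's theorem; normalisation on
`meshContourIntegral_resolvent`. -/

theorem pow_succ_mul_eq_pow_of_le {x y : R} {k n : ℕ} (h : x ^ (k + 1) * y = x ^ k) (hkn : k ≤ n) :
    x ^ (n + 1) * y = x ^ n := by
  obtain ⟨m, rfl⟩ := Nat.exists_eq_add_of_le' hkn
  rw [add_assoc, pow_add, mul_assoc, h, pow_add]

/-- Drazin invertibility as strong `π`-regularity with a commuting witness. -/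
theorem isDrazinInvertible_iff_exists_commute {x : R} :
    IsDrazinInvertible x ↔ ∃ (y : R) (k : ℕ), Commute x y ∧ x ^ (k + 1) * y = x ^ k := by
  constructor
  · rintro ⟨b, k, -, h2, h3⟩
    refine ⟨b, k, h2, ?_⟩
    rw [pow_succ, mul_assoc, h2, ← mul_assoc, h3]
  · rintro ⟨y, k, hc, h⟩
    have key : ∀ m : ℕ, x ^ (k + m) * y ^ m = x ^ k := by
      intro m
      induction m with
      | zero => simp
      | succ m ih =>
        rw [pow_succ' y, ← mul_assoc, ← add_assoc,
          pow_succ_mul_eq_pow_of_le h (Nat.le_add_right k m), ih]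
    have hcp : ∀ i j : ℕ, Commute (x ^ i) (y ^ j) := fun i j => hc.pow_pow i j
    have hx : Commute x (x ^ k * y ^ (k + 1)) :=
      ((Commute.refl x).pow_right k).mul_right (hc.pow_right (k + 1))
    -- `y` inverts `x` only on multiples of `x ^ k`; the factor `x ^ k` discards the rest, and `key`
    -- with `m = k + 1` cancels the surplus powers.
    refine ⟨x ^ k * y ^ (k + 1), k, ?_, hx, ?_⟩
    · calc x ^ k * y ^ (k + 1) * x * (x ^ k * y ^ (k + 1))
          = x ^ k * (y ^ (k + 1) * x ^ (k + 1)) * y ^ (k + 1) := by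
            rw [pow_succ' x k]; simp only [mul_assoc]
        _ = x ^ (k + (k + 1)) * y ^ (k + 1) * y ^ (k + 1) := by
            rw [← (hcp (k + 1) (k + 1)).eq, ← mul_assoc, ← pow_add]
        _ = x ^ k * y ^ (k + 1) := by rw [key]
    · calc x ^ k * (x ^ k * y ^ (k + 1)) * x = x ^ k * (x * (x ^ k * y ^ (k + 1))) := by
            rw [hx.eq]; simp only [mul_assoc]
        _ = x ^ (k + (k + 1)) * y ^ (k + 1) := by
            rw [pow_add x k, pow_succ' x k]; simp only [mul_assoc]
        _ = x ^ k := key _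

/-- A Drazin inverse of `x` commutes with everything that commutes with `x`. -/
theorem Commute.drazinInverse_right {x b z : R} {k : ℕ} (h1 : b * x * b = b)
    (h2 : x * b = b * x) (h3 : x ^ k * b * x = x ^ k) (hz : Commute z x) : Commute z b := by
  -- The idempotent `e = b x` equals both `b ^ (k + 1) * x ^ (k + 1)` and `x ^ (k + 1) * b ^ (k +
  -- 1)`. As `z` commutes with `x ^ (k + 1)`, the first form gives `e z e = e z`, the second `e z e
  -- = z e`. So `z` commutes with `e`, and `b e = b` carries this over to `b`.
  have he : (b * x) * (b * x) = b * x := by rw [← mul_assoc, h1]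
  have hepow : b ^ (k + 1) * x ^ (k + 1) = b * x := by
    rw [← Commute.mul_pow (show Commute b x from h2.symm)]
    exact IsIdempotentElem.pow_succ_eq k he
  have hepow' : x ^ (k + 1) * b ^ (k + 1) = b * x := by
    rw [← hepow]; exact ((show Commute x b from h2).pow_pow _ _).eq
  have hxe : x ^ (k + 1) * (b * x) = x ^ (k + 1) := by
    rw [pow_succ', mul_assoc, ← mul_assoc (x ^ k), h3]
  have hex : (b * x) * x ^ (k + 1) = x ^ (k + 1) := by
    have : Commute (b * x) (x ^ (k + 1)) :=
      ((show Commute b x from h2.symm).mul_left (Commute.refl x)).pow_right _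
    rw [this.eq, hxe]
  have hzp : z * x ^ (k + 1) = x ^ (k + 1) * z := (hz.pow_right (k + 1)).eq
  have e1 : (b * x) * z * (b * x) = (b * x) * z := by
    calc (b * x) * z * (b * x) = b ^ (k + 1) * (x ^ (k + 1) * z) * (b * x) := by
          rw [← mul_assoc (b ^ (k + 1)), hepow]
      _ = b ^ (k + 1) * (z * (x ^ (k + 1) * (b * x))) := by rw [← hzp]; simp only [mul_assoc]
      _ = b * x * z := by rw [hxe, hzp, ← mul_assoc, hepow]
  have e2 : (b * x) * z * (b * x) = z * (b * x) := by
    calc (b * x) * z * (b * x) = (b * x) * (z * x ^ (k + 1)) * b ^ (k + 1) := by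
          rw [← hepow']; simp only [mul_assoc]
      _ = ((b * x) * x ^ (k + 1)) * z * b ^ (k + 1) := by rw [hzp]; simp only [mul_assoc]
      _ = z * (b * x) := by rw [hex, ← hzp, mul_assoc, hepow']
  have e3 : (b * x) * z = z * (b * x) := e1.symm.trans e2
  have hbe : b * (b * x) = b := by rw [← h2, ← mul_assoc, h1]
  have : b * z = z * b := by
    calc b * z = b * ((b * x) * z) := by rw [← mul_assoc, hbe]
      _ = b * (z * x) * b := by rw [e3, ← h2]; simp only [mul_assoc]
      _ = (b * x) * z * b := by rw [hz.eq]; simp only [mul_assoc]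
      _ = z * b := by rw [e3, mul_assoc, h1]
  exact this.symm

theorem IsDrazinInvertible.mul {u v : R} (hu : IsDrazinInvertible u) (hv : IsDrazinInvertible v)
    (huv : Commute u v) : IsDrazinInvertible (u * v) := by
  obtain ⟨b, k, hb1, hb2, hb3⟩ := hu
  obtain ⟨c, l, hc1, hc2, hc3⟩ := hv
  have hvb : Commute v b := Commute.drazinInverse_right hb1 hb2 hb3 huv.symm
  have huc : Commute u c := Commute.drazinInverse_right hc1 hc2 hc3 huv
  have hb : u ^ (k + 1) * b = u ^ k := by rw [pow_succ, mul_assoc, hb2, ← mul_assoc, hb3]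
  have hc : v ^ (l + 1) * c = v ^ l := by rw [pow_succ, mul_assoc, hc2, ← mul_assoc, hc3]
  refine isDrazinInvertible_iff_exists_commute.2 ⟨b * c, k + l, ?_, ?_⟩
  · exact Commute.mul_left ((show Commute u b from hb2).mul_right huc)
      (hvb.mul_right (show Commute v c from hc2))
  · rw [huv.mul_pow, huv.mul_pow, mul_assoc, ← mul_assoc _ b c, (hvb.pow_left _).eq, mul_assoc b,
      ← mul_assoc, pow_succ_mul_eq_pow_of_le hb (Nat.le_add_right k l),
      pow_succ_mul_eq_pow_of_le hc (Nat.le_add_left l k)]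

theorem IsUnit.isDrazinInvertible {u : R} (hu : IsUnit u) : IsDrazinInvertible u := by
  obtain ⟨w, rfl⟩ := hu
  exact ⟨↑w⁻¹, 0, by simp, by simp, by simp⟩

theorem IsUnit.isDrazinInvertible_mul_iff {u w : R} (hw : IsUnit w) (h : Commute u w) :
    IsDrazinInvertible (u * w) ↔ IsDrazinInvertible u := by
  refine ⟨fun H => ?_, fun H => H.mul hw.isDrazinInvertible h⟩
  obtain ⟨w, rfl⟩ := hw
  have := H.mul (w⁻¹.isUnit.isDrazinInvertible)
    (h.units_inv_right.mul_left ((Commute.refl (w : R)).units_inv_right))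
  simpa [mul_assoc] using this

/-- With `α p ^ (k + 1) + β q ^ (k + 1) = 1`, one has `p ^ k = α p ^ (2 k + 1) + β q (p q) ^ k`. The
first term has enough factors `p`; in the second, `(p q) ^ k = (p q) ^ (k + 1) c` (under `φ`)
supplies the missing one. The witness is the cofactor of `p ^ (k + 1)`. -/
theorem IsDrazinInvertible.of_map_mul {S : Type*} [CommRing S] (φ : S →+* R) {p q : S}
    (hpq : IsCoprime p q) (h : IsDrazinInvertible (φ (p * q))) : IsDrazinInvertible (φ p) := by
  obtain ⟨c, k, hc1, hc2, hc3⟩ := h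
  have hcomm : ∀ r : S, Commute (φ r) c := fun r =>
    Commute.drazinInverse_right hc1 hc2 hc3 ((Commute.all r (p * q)).map φ)
  obtain ⟨α, β, hαβ⟩ : IsCoprime (p ^ (k + 1)) (q ^ (k + 1)) := hpq.pow
  refine isDrazinInvertible_iff_exists_commute.2
    ⟨φ (α * p ^ k) + φ (β * q * q ^ (k + 1)) * c, k, ?_, ?_⟩
  · exact ((Commute.all p _).map φ).add_right (((Commute.all p _).map φ).mul_right (hcomm p))
  · have h1 : φ ((p * q) ^ (k + 1)) * c = φ ((p * q) ^ k) := by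
      rw [map_pow, map_pow, pow_succ, mul_assoc, hc2, ← mul_assoc, hc3]
    have h2 : p ^ (k + 1) * (β * q * q ^ (k + 1)) = β * q * (p * q) ^ (k + 1) := by
      rw [mul_pow]; ring
    rw [mul_add, ← mul_assoc (φ p ^ _), ← map_pow, ← map_mul, ← map_mul, h2,
      map_mul φ (β * q), mul_assoc (φ (β * q)), h1, ← map_mul, ← map_add, ← map_pow]
    congr 1
    calc p ^ (k + 1) * (α * p ^ k) + β * q * (p * q) ^ k
        = p ^ k * (α * p ^ (k + 1) + β * q ^ (k + 1)) := by rw [mul_pow]; ring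
      _ = p ^ k := by rw [hαβ, mul_one]

theorem IsDrazinInvertible.of_pow {u : R} {n : ℕ} (hn : n ≠ 0) (h : IsDrazinInvertible (u ^ n)) :
    IsDrazinInvertible u := by
  obtain ⟨m, rfl⟩ := Nat.exists_eq_succ_of_ne_zero hn
  obtain ⟨b, k, hb1, hb2, hb3⟩ := h
  have hub : Commute u b :=
    Commute.drazinInverse_right hb1 hb2 hb3 ((Commute.refl u).pow_right _)
  -- With `n = m + 1`, `u ^ (n k + 1) * u ^ m * b = (u ^ n) ^ (k + 1) * b = (u ^ n) ^ k`.
  refine isDrazinInvertible_iff_exists_commute.2 ⟨u ^ m * b, (m + 1) * k, ?_, ?_⟩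
  · exact ((Commute.refl u).pow_right m).mul_right hub
  · rw [← mul_assoc, ← pow_add, pow_mul]
    conv_rhs => rw [← hb3]
    rw [mul_assoc, ← hb2, ← mul_assoc, ← pow_succ, ← pow_mul]
    congr 2
    rw [Nat.succ_eq_add_one]
    ring

theorem IsDrazinInvertible.pow {u : R} (h : IsDrazinInvertible u) (n : ℕ) :
    IsDrazinInvertible (u ^ n) := by
  induction n with
  | zero => simpa using isUnit_one.isDrazinInvertible
  | succ n ih =>
    rw [pow_succ]
    exact ih.mul h ((Commute.refl u).pow_left n)

/-- Drazin invertibility of a product of powers of pairwise coprime factors. -/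
theorem isDrazinInvertible_map_prod_pow_iff {S ι : Type*} [CommRing S] (φ : S →+* R)
    (s : Finset ι) (p : ι → S) (n : ι → ℕ) (hn : ∀ i ∈ s, n i ≠ 0)
    (hp : Set.Pairwise (s : Set ι) fun i j => IsCoprime (p i) (p j)) :
    IsDrazinInvertible (φ (∏ i ∈ s, p i ^ n i)) ↔ ∀ i ∈ s, IsDrazinInvertible (φ (p i)) := by
  classical
  induction s using Finset.induction_on with
  | empty => simpa using isUnit_one.isDrazinInvertible
  | insert i s hi ih =>
    have ih' := ih (fun j hj => hn j (Finset.mem_insert_of_mem hj))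
      (hp.mono (by simp))
    have hcop : IsCoprime (p i ^ n i) (∏ j ∈ s, p j ^ n j) := by
      refine IsCoprime.prod_right fun j hj => IsCoprime.pow ?_
      exact hp (by simp) (by simp [hj]) (fun h => hi (h ▸ hj))
    rw [Finset.prod_insert hi, Finset.forall_mem_insert, ← ih']
    constructor
    · intro h
      refine ⟨?_, ?_⟩
      · have := h.of_map_mul φ hcop
        rw [map_pow] at this
        exact this.of_pow (hn i (Finset.mem_insert_self i s))
      · rw [mul_comm] at h
        exact h.of_map_mul φ hcop.symm
    · rintro ⟨h1, h2⟩
      rw [map_mul]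
      refine IsDrazinInvertible.mul ?_ h2 ((Commute.all _ _).map φ)
      rw [map_pow]
      exact h1.pow _

/-- Coprimality is not needed here, in contrast to the Drazin case, where `0 * u` is always Drazin
invertible. -/
theorem isUnit_map_prod_pow_iff {S ι : Type*} [CommRing S] (φ : S →+* R)
    (s : Finset ι) (p : ι → S) (n : ι → ℕ) (hn : ∀ i ∈ s, n i ≠ 0) :
    IsUnit (φ (∏ i ∈ s, p i ^ n i)) ↔ ∀ i ∈ s, IsUnit (φ (p i)) := by
  classical
  induction s using Finset.induction_on with
  | empty => simp
  | insert i s hi ih =>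
    rw [Finset.prod_insert hi, Finset.forall_mem_insert, map_mul,
      ((Commute.all _ _).map φ).isUnit_mul_iff,
      ih (fun j hj => hn j (Finset.mem_insert_of_mem hj)), map_pow,
      isUnit_pow_iff (hn i (Finset.mem_insert_self i s))]

end Drazin

/-! ### Zeros of analytic functions on a compact set -/

section Factorization

variable {f : ℂ → ℂ} {U K : Set ℂ}

/-- A function analytic near `z` and not locally zero there splits off a power of `w - z`. -/
theorem AnalyticOnNhd.exists_eq_pow_mul (hf : AnalyticOnNhd ℂ f U) {z : ℂ}
    (hz : z ∈ U) (hne : ¬ ∀ᶠ w in 𝓝 z, f w = 0) :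
    ∃ (n : ℕ) (g : ℂ → ℂ), AnalyticOnNhd ℂ g U ∧ g z ≠ 0 ∧ ∀ w ∈ U, f w = (w - z) ^ n * g w := by
  obtain ⟨n, g₀, hg₀, hg₀z, hfg⟩ := (hf z hz).exists_eventuallyEq_pow_smul_nonzero_iff.2 hne
  classical
  refine ⟨n, fun w => if w = z then g₀ z else f w / (w - z) ^ n, ?_, by simpa using hg₀z, ?_⟩
  · intro w hw
    by_cases hwz : w = z
    · subst hwz
      refine hg₀.congr ?_
      filter_upwards [hfg] with x hx
      by_cases hxw : x = w
      · simp [hxw]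
      · have : (x - w) ^ n ≠ 0 := pow_ne_zero _ (sub_ne_zero.2 hxw)
        simp only [hxw, if_false]
        rw [hx, smul_eq_mul, mul_div_cancel_left₀ _ this]
    · have h1 : AnalyticAt ℂ (fun x => f x / (x - z) ^ n) w :=
        (hf w hw).div (by fun_prop) (pow_ne_zero _ (sub_ne_zero.2 hwz))
      refine h1.congr ?_
      filter_upwards [isOpen_ne.mem_nhds hwz] with x hx
      rw [if_neg hx]
  · intro w hw
    by_cases hwz : w = z
    · subst hwz
      simpa using hfg.self_of_nhds
    · simp only [hwz, if_false]
      rw [mul_div_cancel₀ _ (pow_ne_zero _ (sub_ne_zero.2 hwz))]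

/-- The points are split off one at a time; the cofactor cannot vanish identically near the next
point, since `f` would too. -/
theorem AnalyticOnNhd.exists_eq_prod_pow_mul (hU : IsOpen U) (hf : AnalyticOnNhd ℂ f U)
    (s : Finset ℂ) (hs : ∀ z ∈ s, z ∈ U) (hne : ∀ z ∈ s, ¬ ∀ᶠ w in 𝓝 z, f w = 0) :
    ∃ (n : ℂ → ℕ) (g : ℂ → ℂ), AnalyticOnNhd ℂ g U ∧ (∀ z ∈ s, g z ≠ 0) ∧
      ∀ w ∈ U, f w = (∏ z ∈ s, (w - z) ^ n z) * g w := by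
  classical
  induction s using Finset.induction_on with
  | empty => exact ⟨0, f, hf, by simp, by simp⟩
  | insert z s hz ih =>
    obtain ⟨n, g, hg, hgs, hfg⟩ := ih (fun x hx => hs x (Finset.mem_insert_of_mem hx))
      (fun x hx => hne x (Finset.mem_insert_of_mem hx))
    have hzU := hs z (Finset.mem_insert_self z s)
    have hfz := hne z (Finset.mem_insert_self z s)
    have hgz : ¬ ∀ᶠ w in 𝓝 z, g w = 0 := fun hg0 => hfz <| by
      filter_upwards [hg0, hU.mem_nhds hzU] with w hw hwU
      rw [hfg w hwU, hw, mul_zero]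
    obtain ⟨m, h, hh, hhz, hgh⟩ := hg.exists_eq_pow_mul hzU hgz
    refine ⟨Function.update n z m, h, hh, ?_, ?_⟩
    · intro x hx
      rcases Finset.mem_insert.1 hx with rfl | hx'
      · exact hhz
      · intro h0
        apply hgs x hx'
        rw [hgh x (hs x hx), h0, mul_zero]
    · intro w hw
      have hprod : ∏ x ∈ s, (w - x) ^ Function.update n z m x = ∏ x ∈ s, (w - x) ^ n x :=
        Finset.prod_congr rfl fun x hx => by
          rw [Function.update_of_ne (ne_of_mem_of_not_mem hx hz)]
      rw [Finset.prod_insert hz, hprod, hfg w hw, hgh w hw, Function.update_self]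
      ring

/-- Infinitely many zeros would accumulate in `K`, against the isolation of zeros. -/
theorem AnalyticOnNhd.finite_zeros_of_isCompact (hf : AnalyticOnNhd ℂ f U) (hK : IsCompact K)
    (hKU : K ⊆ U) (hne : ∀ z ∈ K, ¬ ∀ᶠ w in 𝓝 z, f w = 0) : {z ∈ K | f z = 0}.Finite := by
  by_contra hinf
  obtain ⟨z, hzK, hz⟩ := Set.Infinite.exists_accPt_of_subset_isCompact hinf hK (fun z hz => hz.1)
  refine hne z hzK (((hf z (hKU hzK)).frequently_zero_iff_eventually_zero).1 ?_)
  exact (accPt_iff_frequently_nhdsNE.1 hz).mono fun w hw => hw.2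

/-- If `f` is not constant on any neighbourhood of a component of `K`, then it is not locally
constant at any point of `K`. -/
theorem AnalyticOnNhd.not_eventually_eq_of_connectedComponentIn (hf : AnalyticOnNhd ℂ f U)
    (hKU : K ⊆ U) (hnc : ∀ z ∈ K, ∀ V : Set ℂ, IsOpen V → connectedComponentIn K z ⊆ V →
      ¬ ∃ c : ℂ, ∀ w ∈ V, f w = c) (c : ℂ) {z : ℂ} (hz : z ∈ K) :
    ¬ ∀ᶠ w in 𝓝 z, f w - c = 0 := by
  intro h
  have han : AnalyticOnNhd ℂ (fun w => f w - c) (connectedComponentIn K z) := fun w hw =>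
    (hf w (hKU (connectedComponentIn_subset K z hw))).sub analyticAt_const
  -- The set where `f - c` vanishes locally is open. It contains the whole component: infinite order
  -- of vanishing at one point of a connected set propagates to all its points.
  refine hnc z hz {w | ∀ᶠ x in 𝓝 w, f x - c = 0} isOpen_setOfPred_eventually_nhds ?_
    ⟨c, fun w hw => sub_eq_zero.1 hw.self_of_nhds⟩
  intro w hw
  by_contra hw'
  refine han.analyticOrderAt_ne_top_of_isPreconnected isPreconnected_connectedComponentIn
    hw (mem_connectedComponentIn hz) (fun h' => hw' (analyticOrderAt_eq_top.1 h')) ?_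
  exact analyticOrderAt_eq_top.2 h

end Factorization

/-! ### Mesh contours and Cauchy's theorem -/

section Mesh

open Complex MeasureTheory

variable {E : Type*} [NormedAddCommGroup E] [NormedSpace ℂ E] {K U : Set ℂ} {δ : ℝ}

/-- The integral over the bottom edge of the square `m, n`. -/
noncomputable def hEdgeIntegral (δ : ℝ) (F : ℂ → E) (m n : ℤ) : E :=
  ∫ x : ℝ in (m * δ)..((m + 1) * δ), F (x + (n * δ : ℝ) * I)

/-- The integral over the left edge of the square `m, n`. -/
noncomputable def vEdgeIntegral (δ : ℝ) (F : ℂ → E) (m n : ℤ) : E :=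
  I • ∫ y : ℝ in (n * δ)..((n + 1) * δ), F ((m * δ : ℝ) + y * I)

/-- The integral over the positively oriented boundary of the square `m, n`. -/
noncomputable def squareIntegral (δ : ℝ) (F : ℂ → E) (m n : ℤ) : E :=
  hEdgeIntegral δ F m n - hEdgeIntegral δ F m (n + 1) + vEdgeIntegral δ F (m + 1) n -
    vEdgeIntegral δ F m n

theorem squareIntegral_eq_zero (hδ : 0 < δ) {F : ℂ → E} {m n : ℤ}
    (hF : DifferentiableOn ℂ F (meshSquare δ m n)) : squareIntegral δ F m n = 0 := by
  have h1 : (m : ℝ) * δ ≤ (m + 1) * δ := by nlinarith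
  have h2 : (n : ℝ) * δ ≤ (n + 1) * δ := by nlinarith
  have := integral_boundary_rect_eq_zero_of_differentiableOn F
    (⟨m * δ, n * δ⟩ : ℂ) (⟨(m + 1) * δ, (n + 1) * δ⟩ : ℂ)
    (by
      change DifferentiableOn ℂ F
        (uIcc ((m : ℝ) * δ) ((m + 1) * δ) ×ℂ uIcc ((n : ℝ) * δ) ((n + 1) * δ))
      rwa [uIcc_of_le h1, uIcc_of_le h2])
  simpa [squareIntegral, hEdgeIntegral, vEdgeIntegral] using this

/-- Summation by parts: a sum over edges as a sum over squares. -/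
theorem finsum_edges_eq_finsum_squares {G : Type*} [AddCommGroup G] (c : ℤ → ℤ → ℤ)
    (hc : {p : ℤ × ℤ | c p.1 p.2 ≠ 0}.Finite) (H V : ℤ → ℤ → G) :
    (∑ᶠ p : ℤ × ℤ, ((c p.1 p.2 - c p.1 (p.2 - 1)) • H p.1 p.2 +
      (c (p.1 - 1) p.2 - c p.1 p.2) • V p.1 p.2)) =
    ∑ᶠ p : ℤ × ℤ, c p.1 p.2 • (H p.1 p.2 - H p.1 (p.2 + 1) + V (p.1 + 1) p.2 - V p.1 p.2) := by
  have hs : ∀ W : ℤ × ℤ → G, (Function.support fun p : ℤ × ℤ => c p.1 p.2 • W p).Finite :=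
    fun W => hc.subset fun p hp h => hp (by simp [h])
  -- Reindexing moves the unit shift from the coefficient to the edge.
  have shift : ∀ (e : ℤ × ℤ ≃ ℤ × ℤ) (W : ℤ × ℤ → G),
      (Function.support fun p => c (e.symm p).1 (e.symm p).2 • W p).Finite ∧
      ∑ᶠ p, c (e.symm p).1 (e.symm p).2 • W p = ∑ᶠ p, c p.1 p.2 • W (e p) := by
    intro e W
    constructor
    · refine ((hs fun p => W (e p)).preimage (f := e.symm) e.symm.injective.injOn).subset ?_
      intro p hp
      simpa using hp
    · rw [← finsum_comp_equiv e]
      simp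
  obtain ⟨s1, t1⟩ := shift ((Equiv.refl ℤ).prodCongr (Equiv.addRight 1)) fun p => H p.1 p.2
  obtain ⟨s2, t2⟩ := shift ((Equiv.addRight 1).prodCongr (Equiv.refl ℤ)) fun p => V p.1 p.2
  simp only [Equiv.prodCongr_symm, Equiv.refl_symm, Equiv.prodCongr_apply, Equiv.coe_refl,
    Prod.map_fst, Prod.map_snd, id_eq, Equiv.addRight_symm, Equiv.coe_addRight,
    ← sub_eq_add_neg] at s1 t1 s2 t2
  have s3 := hs fun p => H p.1 p.2
  have s4 := hs fun p => V p.1 p.2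
  have s5 := hs fun p => H p.1 (p.2 + 1)
  have s6 := hs fun p => V (p.1 + 1) p.2
  simp only [sub_smul, smul_sub, smul_add]
  rw [finsum_add_distrib ((s3.union s1).subset (Function.support_sub _ _))
      ((s2.union s4).subset (Function.support_sub _ _)),
    finsum_sub_distrib s3 s1, finsum_sub_distrib s2 s4,
    finsum_sub_distrib (((s3.union s5).subset (Function.support_sub _ _)).union s6 |>.subset
      (Function.support_add _ _)) s4,
    finsum_add_distrib ((s3.union s5).subset (Function.support_sub _ _)) s6,
    finsum_sub_distrib s3 s5, t1, t2]
  abel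

theorem mem_Ico_of_meshIndicator_ne_zero (hδ : 0 < δ) {r : ℝ}
    (hK : K ⊆ Metric.closedBall 0 r) {N : ℕ} (hN : r < N * δ) {m n : ℤ}
    (h : meshIndicator K δ m n ≠ 0) :
    m ∈ Finset.Ico (-N : ℤ) N ∧ n ∈ Finset.Ico (-N : ℤ) N := by
  unfold meshIndicator at h
  obtain ⟨z, hz, hzK⟩ : (meshSquare δ m n ∩ K).Nonempty := by
    by_contra h'
    simp [h'] at h
  have hzr : ‖z‖ ≤ r := by simpa using hK hzK
  obtain ⟨⟨h1, h2⟩, h3, h4⟩ := hz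
  have h5 := abs_le.1 ((abs_re_le_norm z).trans hzr)
  have h6 := abs_le.1 ((abs_im_le_norm z).trans hzr)
  -- From `k δ ≤ x ≤ (k + 1) δ` and `|x| ≤ r < N δ` follow `-N < k + 1` and `k < N`, hence the
  -- half-open range.
  have key : ∀ (k : ℤ) (x : ℝ), k * δ ≤ x → x ≤ (k + 1) * δ → -r ≤ x ∧ x ≤ r →
      k ∈ Finset.Ico (-N : ℤ) N := by
    intro k x hk1 hk2 hx
    rw [Finset.mem_Ico]
    constructor
    · have : (-N : ℝ) < k + 1 := lt_of_mul_lt_mul_right (by linarith) hδ.le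
      have : (-N : ℤ) < k + 1 := by exact_mod_cast this
      omega
    · have : (k : ℝ) < N := lt_of_mul_lt_mul_right (by linarith) hδ.le
      exact_mod_cast this
  exact ⟨key m z.re h1 h2 h5, key n z.im h3 h4 h6⟩

theorem exists_box_of_isBounded (hδ : 0 < δ) (hK : Bornology.IsBounded K) :
    ∀ᶠ N : ℕ in atTop, ∀ m n : ℤ, meshIndicator K δ m n ≠ 0 →
      m ∈ Finset.Ico (-N : ℤ) N ∧ n ∈ Finset.Ico (-N : ℤ) N := by
  obtain ⟨r, hr⟩ := hK.subset_closedBall 0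
  have : Tendsto (fun N : ℕ => (N : ℝ) * δ) atTop atTop :=
    tendsto_natCast_atTop_atTop.atTop_mul_const hδ
  filter_upwards [this.eventually_gt_atTop r] with N hN m n h
  exact mem_Ico_of_meshIndicator_ne_zero hδ hr hN h

theorem finite_meshIndicator_ne_zero (hδ : 0 < δ) (hK : Bornology.IsBounded K) :
    {p : ℤ × ℤ | meshIndicator K δ p.1 p.2 ≠ 0}.Finite := by
  obtain ⟨N, hN⟩ := (exists_box_of_isBounded hδ hK).exists
  refine (Finset.finite_toSet (Finset.Ico (-N : ℤ) N ×ˢ Finset.Ico (-N : ℤ) N)).subset ?_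
  intro p hp
  simpa using hN p.1 p.2 hp

theorem meshContourIntegral_eq_finsum_squares (hδ : 0 < δ) (hK : Bornology.IsBounded K)
    (F : ℂ → E) : meshContourIntegral K δ F =
      ∑ᶠ p : ℤ × ℤ, meshIndicator K δ p.1 p.2 • squareIntegral δ F p.1 p.2 :=
  finsum_edges_eq_finsum_squares _ (finite_meshIndicator_ne_zero hδ hK)
    (hEdgeIntegral δ F) (vEdgeIntegral δ F)

/-- All squares of the mesh of side `δ` that meet `K` lie in `U`. -/
def MeshSubordinate (K U : Set ℂ) (δ : ℝ) : Prop :=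
  0 < δ ∧ ∀ m n : ℤ, meshIndicator K δ m n ≠ 0 → meshSquare δ m n ⊆ U

/-- **Cauchy's theorem** for the mesh contour. -/
theorem meshContourIntegral_eq_zero (h : MeshSubordinate K U δ) (hK : Bornology.IsBounded K)
    {F : ℂ → E} (hF : DifferentiableOn ℂ F U) : meshContourIntegral K δ F = 0 := by
  rw [meshContourIntegral_eq_finsum_squares h.1 hK]
  refine finsum_eq_zero_of_forall_eq_zero fun p => ?_
  by_cases hp : meshIndicator K δ p.1 p.2 = 0
  · simp [hp]
  · rw [squareIntegral_eq_zero h.1 (hF.mono (h.2 _ _ hp)), smul_zero]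

theorem meshIndicator_ne_zero_iff {m n : ℤ} :
    meshIndicator K δ m n ≠ 0 ↔ (meshSquare δ m n ∩ K).Nonempty := by
  unfold meshIndicator
  split_ifs with h <;> simp [h]

theorem dist_le_of_mem_meshSquare {m n : ℤ} {z w : ℂ} (hz : z ∈ meshSquare δ m n)
    (hw : w ∈ meshSquare δ m n) : dist z w ≤ 2 * δ := by
  obtain ⟨⟨h1, h2⟩, h3, h4⟩ := hz
  obtain ⟨⟨h5, h6⟩, h7, h8⟩ := hw
  rw [dist_eq]
  refine (norm_le_abs_re_add_abs_im _).trans ?_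
  have a1 : |(z - w).re| ≤ δ := by rw [sub_re, abs_le]; constructor <;> linarith
  have a2 : |(z - w).im| ≤ δ := by rw [sub_im, abs_le]; constructor <;> linarith
  linarith

/-- A square has diameter at most `2 δ`, so for `δ < ε / 2` those meeting `K` stay in its
`ε`-thickening. -/
theorem eventually_meshSubordinate (hK : IsCompact K) (hU : IsOpen U) (hKU : K ⊆ U) :
    ∀ᶠ δ in 𝓝[>] (0 : ℝ), MeshSubordinate K U δ := by
  obtain ⟨ε, hε, hεU⟩ := hK.exists_thickening_subset_open hU hKU
  filter_upwards [Ioo_mem_nhdsGT (show (0 : ℝ) < ε / 2 by positivity)] with δ hδ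
  refine ⟨hδ.1, fun m n hmn z hz => hεU ?_⟩
  obtain ⟨w, hw, hwK⟩ := meshIndicator_ne_zero_iff.1 hmn
  rw [Metric.mem_thickening_iff]
  exact ⟨w, hwK, (dist_le_of_mem_meshSquare hz hw).trans_lt (by linarith [hδ.2])⟩

end Mesh

/-! ### Integration over chains of paths -/

section PathChain

open MeasureTheory

/-- A finite chain of paths in `S`, with complex coefficients; the coefficient of a path is also to
absorb its (constant) velocity. -/
structure PathChain (S : Set ℂ) where
  /-- the index set of the chain -/
  ι : Type
  /-- the index set is finite -/
  fintype : Fintype ι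
  /-- the coefficients -/
  coeff : ι → ℂ
  /-- the paths -/
  path : ι → ℝ → ℂ
  /-- the initial times -/
  lo : ι → ℝ
  /-- the final times -/
  hi : ι → ℝ
  continuous_path : ∀ i, Continuous (path i)
  mapsTo : ∀ i, MapsTo (path i) (uIcc (lo i) (hi i)) S

namespace PathChain

attribute [instance] PathChain.fintype

variable {S T : Set ℂ} (C : PathChain S) (D : PathChain T)
  {E : Type*} [NormedAddCommGroup E] [NormedSpace ℂ E]

/-- The integral of a function over a chain. -/
noncomputable def integral (F : ℂ → E) : E :=
  ∑ i, C.coeff i • ∫ t in C.lo i..C.hi i, F (C.path i t)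

theorem intervalIntegrable {E : Type*} [NormedAddCommGroup E] {F : ℂ → E} (hF : ContinuousOn F S) (i : C.ι) :
    IntervalIntegrable (fun t => F (C.path i t)) volume (C.lo i) (C.hi i) :=
  (hF.comp (C.continuous_path i).continuousOn (C.mapsTo i)).intervalIntegrable

theorem integral_congr {F G : ℂ → E} (h : EqOn F G S) : C.integral F = C.integral G := by
  refine Finset.sum_congr rfl fun i _ => ?_
  congr 1
  exact intervalIntegral.integral_congr fun t ht => h (C.mapsTo i ht)

theorem integral_add {F G : ℂ → E} (hF : ContinuousOn F S) (hG : ContinuousOn G S) :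
    C.integral (fun z => F z + G z) = C.integral F + C.integral G := by
  unfold integral
  rw [← Finset.sum_add_distrib]
  refine Finset.sum_congr rfl fun i _ => ?_
  rw [intervalIntegral.integral_add (C.intervalIntegrable hF i) (C.intervalIntegrable hG i),
    smul_add]

theorem integral_sub {F G : ℂ → E} (hF : ContinuousOn F S) (hG : ContinuousOn G S) :
    C.integral (fun z => F z - G z) = C.integral F - C.integral G := by
  unfold integral
  rw [← Finset.sum_sub_distrib]
  refine Finset.sum_congr rfl fun i _ => ?_
  rw [intervalIntegral.integral_sub (C.intervalIntegrable hF i) (C.intervalIntegrable hG i),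
    smul_sub]

theorem integral_smul (c : ℂ) (F : ℂ → E) :
    C.integral (fun z => c • F z) = c • C.integral F := by
  unfold integral
  rw [Finset.smul_sum]
  refine Finset.sum_congr rfl fun i _ => ?_
  rw [intervalIntegral.integral_smul, smul_comm]

theorem integral_clm_comp [CompleteSpace E] {G : Type*} [NormedAddCommGroup G] [NormedSpace ℂ G]
    [CompleteSpace G] (L : E →L[ℂ] G) {F : ℂ → E} (hF : ContinuousOn F S) :
    C.integral (fun z => L (F z)) = L (C.integral F) := by
  unfold integral
  rw [map_sum]
  refine Finset.sum_congr rfl fun i _ => ?_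
  rw [L.intervalIntegral_comp_comm (C.intervalIntegrable hF i), map_smul]

/-- Joint continuity gives integrability on each compact parameter rectangle, so Fubini applies to
every pair of paths. -/
theorem integral_integral_swap {F : ℂ → ℂ → E}
    (hF : ContinuousOn (Function.uncurry F) (S ×ˢ T)) :
    C.integral (fun z => D.integral fun w => F z w) =
      D.integral fun w => C.integral fun z => F z w := by
  have hcomp : ∀ (i : C.ι) (j : D.ι), ContinuousOn
      (Function.uncurry fun t u => F (C.path i t) (D.path j u))
      (uIcc (C.lo i) (C.hi i) ×ˢ uIcc (D.lo j) (D.hi j)) := by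
    intro i j
    exact hF.comp (f := fun p : ℝ × ℝ => (C.path i p.1, D.path j p.2))
      (((C.continuous_path i).comp continuous_fst).prodMk
        ((D.continuous_path j).comp continuous_snd)).continuousOn
      fun p hp => ⟨C.mapsTo i hp.1, D.mapsTo j hp.2⟩
  have hint : ∀ (i : C.ι) (j : D.ι), IntegrableOn
      (Function.uncurry fun t u => F (C.path i t) (D.path j u))
      (uIoc (C.lo i) (C.hi i) ×ˢ uIoc (D.lo j) (D.hi j)) := fun i j =>
    ((hcomp i j).integrableOn_compact (isCompact_uIcc.prod isCompact_uIcc)).mono_set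
      (prod_mono uIoc_subset_uIcc uIoc_subset_uIcc)
  have hint' : ∀ (i : C.ι) (j : D.ι), Integrable
      (Function.uncurry fun t u => F (C.path i t) (D.path j u))
      ((volume.restrict (uIoc (C.lo i) (C.hi i))).prod
        (volume.restrict (uIoc (D.lo j) (D.hi j)))) := fun i j => by
    rw [Measure.prod_restrict, ← Measure.volume_eq_prod]
    exact hint i j
  have hleft : ∀ (i : C.ι) (j : D.ι), IntervalIntegrable
      (fun t => D.coeff j • ∫ u in D.lo j..D.hi j, F (C.path i t) (D.path j u)) volume
      (C.lo i) (C.hi i) := by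
    intro i j
    rw [intervalIntegrable_iff]
    simp only [intervalIntegral.intervalIntegral_eq_integral_uIoc]
    exact ((hint' i j).integral_prod_left.smul _).smul _
  have hright : ∀ (i : C.ι) (j : D.ι), IntervalIntegrable
      (fun u => C.coeff i • ∫ t in C.lo i..C.hi i, F (C.path i t) (D.path j u)) volume
      (D.lo j) (D.hi j) := by
    intro i j
    rw [intervalIntegrable_iff]
    simp only [intervalIntegral.intervalIntegral_eq_integral_uIoc]
    exact ((hint' i j).integral_prod_right.smul _).smul _
  unfold integral
  simp_rw [intervalIntegral.integral_finsetSum (fun j _ => hleft _ j),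
    intervalIntegral.integral_finsetSum (fun i _ => hright i _), Finset.smul_sum,
    intervalIntegral.integral_smul]
  rw [Finset.sum_comm]
  refine Finset.sum_congr rfl fun j _ => Finset.sum_congr rfl fun i _ => ?_
  rw [intervalIntegral_intervalIntegral_swap (hint i j), smul_comm]

end PathChain

end PathChain

/-! ### Mesh contours as chains, and telescoping sums -/

section MeshChain

open Complex MeasureTheory

variable {E : Type*} [NormedAddCommGroup E] [NormedSpace ℂ E] {K U : Set ℂ} {δ : ℝ}

theorem meshIndicator_eq_one {m n : ℤ} {z : ℂ} (hz : z ∈ meshSquare δ m n) (hzK : z ∈ K) :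
    meshIndicator K δ m n = 1 :=
  if_pos ⟨z, hz, hzK⟩

/-- Edges with non-zero coefficient lie in `U` and do not meet `K`. -/
theorem MeshSubordinate.mem_diff_of_mem_meshSquare (h : MeshSubordinate K U δ) {m n m' n' : ℤ}
    (hne : meshIndicator K δ m n - meshIndicator K δ m' n' ≠ 0) {z : ℂ}
    (hz : z ∈ meshSquare δ m n) (hz' : z ∈ meshSquare δ m' n') : z ∈ U \ K := by
  constructor
  · by_cases h0 : meshIndicator K δ m n = 0
    · exact h.2 m' n' (fun h1 => hne (by rw [h0, h1, sub_zero])) hz'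
    · exact h.2 m n h0 hz
  -- A point of `K` on the edge would make both adjacent squares meet `K`, and the coefficients
  -- would cancel.
  · intro hzK
    exact hne (by rw [meshIndicator_eq_one hz hzK, meshIndicator_eq_one hz' hzK, sub_self])

theorem horizontal_mem_meshSquare (hδ : 0 < δ) {m n : ℤ} {t : ℝ}
    (ht : t ∈ uIcc (m * δ) ((m + 1) * δ)) :
    (t : ℂ) + (n * δ : ℝ) * I ∈ meshSquare δ m n ∧
      (t : ℂ) + (n * δ : ℝ) * I ∈ meshSquare δ m (n - 1) := by
  rw [uIcc_of_le (by nlinarith)] at ht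
  simp only [meshSquare, mem_reProdIm, add_re, mul_re, ofReal_re, I_re, ofReal_im, I_im, add_im,
    mul_im, mul_zero, mul_one, sub_zero, add_zero, zero_add, ht, true_and, mem_Icc,
    le_refl, Int.cast_sub, Int.cast_one, sub_add_cancel, and_true]
  constructor <;> nlinarith

theorem vertical_mem_meshSquare (hδ : 0 < δ) {m n : ℤ} {t : ℝ}
    (ht : t ∈ uIcc (n * δ) ((n + 1) * δ)) :
    ((m * δ : ℝ) : ℂ) + t * I ∈ meshSquare δ m n ∧
      ((m * δ : ℝ) : ℂ) + t * I ∈ meshSquare δ (m - 1) n := by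
  rw [uIcc_of_le (by nlinarith)] at ht
  simp only [meshSquare, mem_reProdIm, add_re, mul_re, ofReal_re, I_re, ofReal_im, I_im, add_im,
    mul_im, mul_zero, mul_one, sub_zero, add_zero, zero_add, ht, mem_Icc,
    le_refl, Int.cast_sub, Int.cast_one, sub_add_cancel, and_true]
  exact ⟨⟨trivial, by nlinarith⟩, by nlinarith⟩

/-- The mesh contour around `K` is a chain of paths in `U \ K`. -/
theorem MeshSubordinate.exists_pathChain (h : MeshSubordinate K U δ)
    (hK : Bornology.IsBounded K) : ∃ C : PathChain (U \ K),
      ∀ F : ℂ → E, meshContourIntegral K δ F = C.integral F := by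
  have hfin := finite_meshIndicator_ne_zero h.1 hK
  let cH : ℤ × ℤ → ℤ := fun p => meshIndicator K δ p.1 p.2 - meshIndicator K δ p.1 (p.2 - 1)
  let cV : ℤ × ℤ → ℤ := fun p => meshIndicator K δ (p.1 - 1) p.2 - meshIndicator K δ p.1 p.2
  have hH : {p | cH p ≠ 0}.Finite := by
    refine (hfin.union (hfin.preimage
      (((Equiv.refl ℤ).prodCongr (Equiv.subRight 1)).injective.injOn))).subset fun p hp => ?_
    by_contra hp'
    rw [mem_union, not_or] at hp'
    exact hp (by simpa [cH, sub_eq_zero] using (not_not.1 hp'.1).trans (not_not.1 hp'.2).symm)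
  have hV : {p | cV p ≠ 0}.Finite := by
    refine (hfin.union (hfin.preimage
      (((Equiv.subRight 1).prodCongr (Equiv.refl ℤ)).injective.injOn))).subset fun p hp => ?_
    by_contra hp'
    rw [mem_union, not_or] at hp'
    exact hp (by simpa [cV, sub_eq_zero] using (not_not.1 hp'.2).trans (not_not.1 hp'.1).symm)
  refine ⟨{
    ι := hH.toFinset ⊕ hV.toFinset
    fintype := inferInstance
    -- The factor `I` is the velocity along vertical edges.
    coeff := Sum.elim (fun p => (cH p : ℂ)) (fun p => (cV p : ℂ) * I)
    path := Sum.elim (fun p t => (t : ℂ) + (p.1.2 * δ : ℝ) * I)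
      (fun p t => ((p.1.1 * δ : ℝ) : ℂ) + t * I)
    lo := Sum.elim (fun p => p.1.1 * δ) (fun p => p.1.2 * δ)
    hi := Sum.elim (fun p => (p.1.1 + 1) * δ) (fun p => (p.1.2 + 1) * δ)
    continuous_path := ?_
    mapsTo := ?_ }, ?_⟩
  · rintro (p | p) <;> simp only [Sum.elim_inl, Sum.elim_inr] <;> fun_prop
  · rintro (p | p) t ht
    · have hp := hH.mem_toFinset.1 p.2
      obtain ⟨h1, h2⟩ := horizontal_mem_meshSquare (n := p.1.2) h.1 ht
      exact h.mem_diff_of_mem_meshSquare hp h1 h2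
    · have hp := hV.mem_toFinset.1 p.2
      obtain ⟨h1, h2⟩ := vertical_mem_meshSquare (m := p.1.1) h.1 ht
      exact h.mem_diff_of_mem_meshSquare hp h2 h1
  · intro F
    have e1 : meshContourIntegral K δ F = ∑ᶠ p : ℤ × ℤ,
        (cH p • hEdgeIntegral δ F p.1 p.2 + cV p • vEdgeIntegral δ F p.1 p.2) := rfl
    have sH : (Function.support fun p => cH p • hEdgeIntegral δ F p.1 p.2) ⊆ hH.toFinset := by
      intro p hp
      rw [Finite.coe_toFinset]
      exact fun h0 => hp (by simp [h0])
    have sV : (Function.support fun p => cV p • vEdgeIntegral δ F p.1 p.2) ⊆ hV.toFinset := by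
      intro p hp
      rw [Finite.coe_toFinset]
      exact fun h0 => hp (by simp [h0])
    rw [e1, finsum_add_distrib ((Finset.finite_toSet _).subset sH)
      ((Finset.finite_toSet _).subset sV), finsum_eq_sum_of_support_subset _ sH,
      finsum_eq_sum_of_support_subset _ sV, PathChain.integral, Fintype.sum_sum_type]
    simp only [Sum.elim_inl, Sum.elim_inr]
    rw [← Finset.sum_coe_sort hH.toFinset, ← Finset.sum_coe_sort hV.toFinset]
    congr 1
    · refine Finset.sum_congr rfl fun p _ => ?_
      rw [Int.cast_smul_eq_zsmul]
      rfl
    · refine Finset.sum_congr rfl fun p _ => ?_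
      rw [mul_smul, Int.cast_smul_eq_zsmul]
      rfl

/-- The integral over the positively oriented boundary of the square `[-L, L] × [-L, L]`. -/
noncomputable def boxIntegral (L : ℝ) (F : ℂ → E) : E :=
  (∫ x : ℝ in (-L)..L, F (x + (-L : ℝ) * I)) - (∫ x : ℝ in (-L)..L, F (x + (L : ℝ) * I)) +
    I • (∫ y : ℝ in (-L)..L, F ((L : ℝ) + y * I)) -
    I • ∫ y : ℝ in (-L)..L, F ((-L : ℝ) + y * I)

theorem sum_Ico_int_telescope {G : Type*} [AddCommGroup G] (g : ℤ → G) (a : ℤ) (k : ℕ) :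
    ∑ m ∈ Finset.Ico a (a + k), (g (m + 1) - g m) = g (a + k) - g a := by
  induction k with
  | zero => simp
  | succ k ih =>
    have : Finset.Ico a (a + (k + 1 : ℕ)) = insert (a + k : ℤ) (Finset.Ico a (a + k)) := by
      ext x
      simp only [Finset.mem_Ico, Finset.mem_insert]
      omega
    rw [this, Finset.sum_insert (by simp), ih]
    push_cast
    rw [add_assoc]
    abel

theorem sum_Ico_neg_telescope {G : Type*} [AddCommGroup G] (g : ℤ → G) (N : ℕ) :
    ∑ m ∈ Finset.Ico (-N : ℤ) N, (g (m + 1) - g m) = g N - g (-N) := by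
  have := sum_Ico_int_telescope g (-N) (N + N)
  have e : (-N : ℤ) + (N + N : ℕ) = N := by push_cast; ring
  rwa [e] at this

theorem sum_Ico_neg_intervalIntegral {f : ℝ → E} (N : ℕ)
    (hf : ∀ x y : ℝ, IntervalIntegrable f volume x y) :
    ∑ m ∈ Finset.Ico (-N : ℤ) N, (∫ x in (m * δ)..((m + 1) * δ), f x) =
      ∫ x in (-(N * δ))..(N * δ), f x := by
  have := sum_Ico_neg_telescope (fun m : ℤ => ∫ x in (0 : ℝ)..(m * δ), f x) N
  simp only [Int.cast_add, Int.cast_one, Int.cast_neg, Int.cast_natCast,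
    intervalIntegral.integral_interval_sub_left (hf _ _) (hf _ _)] at this
  rw [this, neg_mul]

end MeshChain

/-! ### Integrals over the boundary of a large square -/

section Box

open Complex MeasureTheory

variable {E : Type*} [NormedAddCommGroup E] [NormedSpace ℂ E] {K : Set ℂ} {δ : ℝ}

theorem le_norm_horizontal (L x : ℝ) : |L| ≤ ‖(x : ℂ) + (L : ℝ) * I‖ := by
  have := abs_im_le_norm ((x : ℂ) + (L : ℝ) * I)
  simpa using this

theorem le_norm_vertical (L y : ℝ) : |L| ≤ ‖(L : ℂ) + (y : ℝ) * I‖ := by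
  have := abs_re_le_norm ((L : ℂ) + (y : ℝ) * I)
  simpa using this

/-- The boundary of the square `[-L, L] × [-L, L]` as a chain. -/
def boxChain (L : ℝ) : PathChain {z : ℂ | L ≤ ‖z‖} where
  ι := Fin 4
  fintype := inferInstance
  coeff := ![1, -1, I, -I]
  path := ![fun x => x + (-L : ℝ) * I, fun x => x + (L : ℝ) * I, fun y => (L : ℝ) + y * I,
    fun y => (-L : ℝ) + y * I]
  lo := fun _ => -L
  hi := fun _ => L
  continuous_path := by
    intro i
    fin_cases i <;> simp <;> fun_prop
  mapsTo := by
    intro i t _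
    have h1 := le_norm_horizontal (-L) t
    have h2 := le_norm_horizontal L t
    have h3 := le_norm_vertical (-L) t
    have h4 := le_norm_vertical L t
    rw [abs_neg] at h1 h3
    have hL := le_abs_self L
    fin_cases i
    · exact hL.trans h1
    · exact hL.trans h2
    · exact hL.trans h4
    · exact hL.trans h3

theorem boxChain_integral (L : ℝ) (F : ℂ → E) : (boxChain L).integral F = boxIntegral L F := by
  unfold PathChain.integral
  change ∑ i : Fin 4, _ = _
  rw [Fin.sum_univ_four]
  simp only [boxIntegral, boxChain, Matrix.cons_val]
  simp only [one_smul, neg_smul]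
  abel

/-- The factor `8 * L` is the perimeter of the square. -/
theorem norm_boxIntegral_le {L M : ℝ} (hL : 0 ≤ L) {F : ℂ → E} (hF : ∀ z : ℂ, L ≤ ‖z‖ → ‖F z‖ ≤ M) :
    ‖boxIntegral L F‖ ≤ 8 * L * M := by
  have key : ∀ γ : ℝ → ℂ, (∀ t, L ≤ ‖γ t‖) → ‖∫ t in (-L)..L, F (γ t)‖ ≤ M * (2 * L) := by
    intro γ hγ
    have := intervalIntegral.norm_integral_le_of_norm_le_const (a := -L) (b := L)
      (f := fun t => F (γ t)) (C := M) fun t _ => hF _ (hγ t)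
    rwa [abs_of_nonneg (by linarith), show L - -L = 2 * L by ring] at this
  have habs : |L| = L := abs_of_nonneg hL
  have k1 := key (fun x => x + (-L : ℝ) * I) fun t => by
    simpa [habs] using le_norm_horizontal (-L) t
  have k2 := key (fun x => x + (L : ℝ) * I) fun t => by
    simpa [habs] using le_norm_horizontal L t
  have k3 := key (fun y => (L : ℝ) + y * I) fun t => by
    simpa [habs] using le_norm_vertical L t
  have k4 := key (fun y => (-L : ℝ) + y * I) fun t => by
    simpa [habs] using le_norm_vertical (-L) t
  unfold boxIntegral
  refine (norm_sub_le _ _).trans ?_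
  refine (add_le_add_left (norm_add_le _ _) _).trans ?_
  refine (add_le_add_left (add_le_add_left (norm_sub_le _ _) _) _).trans ?_
  rw [norm_smul, norm_smul, norm_I, one_mul, one_mul]
  linarith

/-- Opposite sides are paired. Each pair reduces to `I` times the real integral of `2 L / (x ^ 2 + L
^ 2)` over `[-L, L]`, which is `π` by the arctangent. -/
theorem boxIntegral_inv {L : ℝ} (hL : 0 < L) :
    boxIntegral L (fun z => z⁻¹) = 2 * Real.pi * I := by
  have hcont : ∀ F : ℝ → ℂ, Continuous F → (∀ t, F t ≠ 0) →
      IntervalIntegrable (fun t => (F t)⁻¹) volume (-L) L := fun F hF h0 =>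
    (hF.inv₀ h0).intervalIntegrable _ _
  have hne1 : ∀ M : ℝ, M ≠ 0 → ∀ x : ℝ, (x : ℂ) + (M : ℝ) * I ≠ 0 := fun M hM x h => by
    have := le_norm_horizontal M x
    rw [h, norm_zero] at this
    exact hM (abs_nonpos_iff.1 this)
  have hne2 : ∀ M : ℝ, M ≠ 0 → ∀ x : ℝ, ((M : ℝ) : ℂ) + x * I ≠ 0 := fun M hM x h => by
    have := le_norm_vertical M x
    rw [h, norm_zero] at this
    exact hM (abs_nonpos_iff.1 this)
  have i1 := hcont _ (by fun_prop) (hne1 (-L) (by simpa using hL.ne'))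
  have i2 := hcont _ (by fun_prop) (hne1 L hL.ne')
  have i3 := hcont _ (by fun_prop) (hne2 L hL.ne')
  have i4 := hcont _ (by fun_prop) (hne2 (-L) (by simpa using hL.ne'))
  have hreal : ∫ x : ℝ in (-L)..L, (2 * L / (x ^ 2 + L ^ 2) : ℝ) = Real.pi := by
    have hpos : ∀ x : ℝ, 0 < x ^ 2 + L ^ 2 := fun x => by positivity
    have hd : ∀ x : ℝ, HasDerivAt (fun x => 2 * Real.arctan (x / L))
        (2 * L / (x ^ 2 + L ^ 2)) x := fun x => by
      have := (((hasDerivAt_id x).div_const L).arctan).const_mul 2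
      refine this.congr_deriv ?_
      have h1 := (hpos x).ne'
      have h2 : 1 + (x / L) ^ 2 ≠ 0 := by positivity
      simp only [id]
      field_simp
      ring
    rw [intervalIntegral.integral_eq_sub_of_hasDerivAt (fun x _ => hd x)]
    · rw [neg_div, div_self hL.ne', Real.arctan_neg, Real.arctan_one]
      ring
    · refine Continuous.intervalIntegrable ?_ _ _
      exact continuous_const.div (by fun_prop) fun x => (hpos x).ne'
  have hfun1 : ∀ x : ℝ, ((x : ℂ) + (-L : ℝ) * I)⁻¹ - ((x : ℂ) + (L : ℝ) * I)⁻¹ =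
      I * ((2 * L / (x ^ 2 + L ^ 2) : ℝ) : ℂ) := by
    intro x
    have h1 := hne1 (-L) (by simpa using hL.ne') x
    have h2 := hne1 L hL.ne' x
    have h3 : ((x ^ 2 + L ^ 2 : ℝ) : ℂ) = (x + (-L : ℝ) * I) * (x + (L : ℝ) * I) := by
      push_cast
      ring_nf
      rw [I_sq]
      ring
    rw [inv_sub_inv h1 h2, ofReal_div, h3, mul_div_assoc']
    congr 1
    push_cast
    ring
  have hfun2 : ∀ y : ℝ, (((L : ℝ) : ℂ) + y * I)⁻¹ - (((-L : ℝ) : ℂ) + y * I)⁻¹ =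
      ((2 * L / (y ^ 2 + L ^ 2) : ℝ) : ℂ) := by
    intro y
    have h1 := hne2 L hL.ne' y
    have h2 := hne2 (-L) (by simpa using hL.ne') y
    have h3 : ((y ^ 2 + L ^ 2 : ℝ) : ℂ) = -(((L : ℝ) + y * I) * ((-L : ℝ) + y * I)) := by
      push_cast
      ring_nf
      rw [I_sq]
      ring
    rw [inv_sub_inv h1 h2, ofReal_div, h3, div_neg, ← neg_div]
    congr 1
    push_cast
    ring
  unfold boxIntegral
  rw [add_sub_assoc, ← smul_sub, ← intervalIntegral.integral_sub i1 i2,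
    ← intervalIntegral.integral_sub i3 i4]
  simp only [hfun1, hfun2]
  rw [intervalIntegral.integral_const_mul, intervalIntegral.integral_ofReal, hreal, smul_eq_mul]
  ring

/-- The mesh contour around `K` can be replaced by the boundary of a big square if the integrand is
holomorphic off `K`. -/
theorem meshContourIntegral_eq_boxIntegral (hδ : 0 < δ) (hK : Bornology.IsBounded K)
    {F : ℂ → E} (hF : DifferentiableOn ℂ F Kᶜ) :
    ∀ᶠ N : ℕ in atTop, meshContourIntegral K δ F = boxIntegral (N * δ) F := by
  obtain ⟨r, hr⟩ := hK.subset_closedBall 0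
  have hlim : Tendsto (fun N : ℕ => (N : ℝ) * δ) atTop atTop :=
    tendsto_natCast_atTop_atTop.atTop_mul_const hδ
  filter_upwards [exists_box_of_isBounded hδ hK, hlim.eventually_gt_atTop r] with N hN hrN
  have hoff : ∀ z : ℂ, N * δ ≤ ‖z‖ → z ∈ Kᶜ := fun z hz hzK => by
    have : ‖z‖ ≤ r := by simpa using hr hzK
    linarith
  have hline : ∀ γ : ℝ → ℂ, Continuous γ → (∀ t, N * δ ≤ ‖γ t‖) → ∀ x y : ℝ,
      IntervalIntegrable (fun t => F (γ t)) volume x y := fun γ hγ h x y =>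
    (hF.continuousOn.comp_continuous hγ fun t => hoff _ (h t)).intervalIntegrable _ _
  have hNδ : |(N : ℝ) * δ| = N * δ := abs_of_nonneg (by positivity)
  rw [meshContourIntegral_eq_finsum_squares hδ hK,
    finsum_eq_sum_of_support_subset (s := Finset.Ico (-N : ℤ) N ×ˢ Finset.Ico (-N : ℤ) N)]
  swap
  · intro p hp
    have := hN p.1 p.2 fun h0 => hp (by simp [h0])
    simpa using this
  -- A square that misses `K` contributes zero by Cauchy's theorem, so every coefficient in the box
  -- may be taken to be `1`; then the inner edges telescope away.
  have h1 : ∀ p : ℤ × ℤ, meshIndicator K δ p.1 p.2 • squareIntegral δ F p.1 p.2 =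
      squareIntegral δ F p.1 p.2 := by
    intro p
    by_cases h : (meshSquare δ p.1 p.2 ∩ K).Nonempty
    · rw [meshIndicator, if_pos h, one_smul]
    · rw [squareIntegral_eq_zero hδ (hF.mono fun z hz hzK => h ⟨z, hz, hzK⟩), smul_zero]
  rw [Finset.sum_congr rfl fun p _ => h1 p, Finset.sum_product]
  have h2 : ∀ m n : ℤ, squareIntegral δ F m n =
      (vEdgeIntegral δ F (m + 1) n - vEdgeIntegral δ F m n) -
      (hEdgeIntegral δ F m (n + 1) - hEdgeIntegral δ F m n) := by
    intro m n
    unfold squareIntegral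
    abel
  have hV : ∑ m ∈ Finset.Ico (-N : ℤ) N, ∑ n ∈ Finset.Ico (-N : ℤ) N,
      (vEdgeIntegral δ F (m + 1) n - vEdgeIntegral δ F m n) =
      I • (∫ y : ℝ in (-(N * δ))..(N * δ), F ((N * δ : ℝ) + y * I)) -
        I • ∫ y : ℝ in (-(N * δ))..(N * δ), F ((-(N * δ) : ℝ) + y * I) := by
    rw [Finset.sum_comm, Finset.sum_congr rfl fun n _ =>
      sum_Ico_neg_telescope (fun m => vEdgeIntegral δ F m n) N, Finset.sum_sub_distrib]
    simp only [vEdgeIntegral, ← Finset.smul_sum]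
    rw [sum_Ico_neg_intervalIntegral, sum_Ico_neg_intervalIntegral]
    · simp
    · exact hline _ (by fun_prop) fun t => by simpa [hNδ] using le_norm_vertical (-(N * δ)) t
    · exact hline _ (by fun_prop) fun t => by simpa [hNδ] using le_norm_vertical (N * δ) t
  have hH : ∑ m ∈ Finset.Ico (-N : ℤ) N, ∑ n ∈ Finset.Ico (-N : ℤ) N,
      (hEdgeIntegral δ F m (n + 1) - hEdgeIntegral δ F m n) =
      (∫ x : ℝ in (-(N * δ))..(N * δ), F (x + (N * δ : ℝ) * I)) -
        ∫ x : ℝ in (-(N * δ))..(N * δ), F (x + (-(N * δ) : ℝ) * I) := by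
    rw [Finset.sum_congr rfl fun m _ =>
      sum_Ico_neg_telescope (fun n => hEdgeIntegral δ F m n) N, Finset.sum_sub_distrib]
    simp only [hEdgeIntegral]
    rw [sum_Ico_neg_intervalIntegral, sum_Ico_neg_intervalIntegral]
    · simp
    · exact hline _ (by fun_prop) fun t => by simpa [hNδ] using le_norm_horizontal (-(N * δ)) t
    · exact hline _ (by fun_prop) fun t => by simpa [hNδ] using le_norm_horizontal (N * δ) t
  simp only [h2]
  simp only [Finset.sum_sub_distrib] at hV hH ⊢
  rw [hV, hH, boxIntegral]
  abel

end Box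

/-! ### Divided differences -/

section Dslope

variable {g : ℂ → ℂ} {U : Set ℂ}

theorem dslope_comm (g : ℂ → ℂ) (z w : ℂ) : dslope g z w = dslope g w z := by
  by_cases h : z = w
  · rw [h]
  · rw [dslope_of_ne _ (Ne.symm h), dslope_of_ne _ h, slope_comm]

/-- The divided difference of a holomorphic function is jointly continuous. -/
theorem DifferentiableOn.continuousOn_uncurry_dslope (hU : IsOpen U)
    (hg : DifferentiableOn ℂ g U) : ContinuousOn (Function.uncurry (dslope g)) (U ×ˢ U) := by
  rintro ⟨z, w⟩ ⟨hz, hw⟩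
  refine ContinuousAt.continuousWithinAt ?_
  have hgz : ∀ x ∈ U, ContinuousAt g x := fun x hx =>
    (hg.differentiableAt (hU.mem_nhds hx)).continuousAt
  by_cases hzw : z = w
  · subst hzw
    have han : AnalyticAt ℂ g z := hg.analyticAt (hU.mem_nhds hz)
    -- Near a diagonal point, strict differentiability controls the quotients off the diagonal and
    -- continuity of the derivative controls the values on it.
    have hstrict := han.hasStrictDerivAt.hasStrictFDerivAt.isLittleO
    have hderiv : ContinuousAt (fun p : ℂ × ℂ => _root_.deriv g p.1) (z, z) :=
      ContinuousAt.comp (g := _root_.deriv g) han.deriv.continuousAt continuousAt_fst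
    rw [Metric.continuousAt_iff'] at hderiv ⊢
    intro ε hε
    filter_upwards [hderiv ε hε, hstrict.def (half_pos hε)] with p h1 h2
    simp only [Function.uncurry, dslope_same]
    by_cases hp : p.1 = p.2
    · rw [← hp, dslope_same]
      exact h1
    · rw [dslope_comm, dslope_of_ne _ hp, slope_def_field, dist_eq_norm]
      have hne : p.1 - p.2 ≠ 0 := sub_ne_zero.2 hp
      have e : (g p.1 - g p.2) / (p.1 - p.2) - _root_.deriv g z =
          (g p.1 - g p.2 - (p.1 - p.2) * _root_.deriv g z) / (p.1 - p.2) := by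
        field_simp
      rw [e, norm_div, div_lt_iff₀ (norm_pos_iff.2 hne)]
      have h3 : ‖g p.1 - g p.2 - (p.1 - p.2) * _root_.deriv g z‖ ≤ ε / 2 * ‖p.1 - p.2‖ := by
        simpa using h2
      have := norm_pos_iff.2 hne
      nlinarith
  · have hne : ∀ᶠ p : ℂ × ℂ in 𝓝 (z, w), p.1 ≠ p.2 :=
      (isOpen_ne_fun continuous_fst continuous_snd).mem_nhds hzw
    have hc : ContinuousAt (fun p : ℂ × ℂ => (g p.2 - g p.1) / (p.2 - p.1)) (z, w) :=
      ((ContinuousAt.comp (g := g) (hgz w hw) continuousAt_snd).sub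
        (ContinuousAt.comp (g := g) (hgz z hz) continuousAt_fst)).div
        (continuousAt_snd.sub continuousAt_fst) (sub_ne_zero.2 (Ne.symm hzw))
    refine hc.congr ?_
    filter_upwards [hne] with p hp
    rw [Function.uncurry, dslope_of_ne _ (Ne.symm hp), slope_def_field]

end Dslope

/-! ### The integral of the resolvent -/

section ResolventIntegral

theorem sub_mul_resolvent {A : Type*} [Ring A] [Algebra ℂ A] {a : A} {z : ℂ}
    (hz : z ∉ spectrum ℂ a) :
    (algebraMap ℂ A z - a) * resolvent a z = 1 :=
  Ring.mul_inverse_cancel _ (not_not.1 hz)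

theorem resolvent_mul_sub {A : Type*} [Ring A] [Algebra ℂ A] {a : A} {z : ℂ}
    (hz : z ∉ spectrum ℂ a) :
    resolvent a z * (algebraMap ℂ A z - a) = 1 :=
  Ring.inverse_mul_cancel _ (not_not.1 hz)

variable {A : Type*} [NormedRing A] [NormedAlgebra ℂ A] [CompleteSpace A] {U : Set ℂ} {δ : ℝ}

theorem differentiableOn_resolvent (a : A) : DifferentiableOn ℂ (resolvent a) (spectrum ℂ a)ᶜ :=
  fun _ hz =>
    (spectrum.hasDerivAt_resolvent_const_left
      (not_not.1 hz)).differentiableAt.differentiableWithinAt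

theorem continuousOn_resolvent (a : A) : ContinuousOn (resolvent a) (U \ spectrum ℂ a) :=
  (differentiableOn_resolvent a).continuousOn.mono fun _ hz => hz.2

theorem boxIntegral_inv_smul {L : ℝ} (hL : 0 < L) (c : A) :
    boxIntegral L (fun z : ℂ => z⁻¹ • c) = (2 * Real.pi * Complex.I : ℂ) • c := by
  have hcont : ContinuousOn (fun z : ℂ => z⁻¹) {z : ℂ | L ≤ ‖z‖} :=
    continuousOn_id.inv₀ fun z hz => norm_pos_iff.1 (hL.trans_le hz)
  have := (boxChain L).integral_clm_comp (ContinuousLinearMap.toSpanSingleton ℂ c) hcont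
  simpa [boxChain_integral, boxIntegral_inv hL] using this

/-- The resolvent integrates to `2 π i` over a contour surrounding the spectrum. -/
theorem meshContourIntegral_resolvent (hδ : 0 < δ) (a : A) :
    meshContourIntegral (spectrum ℂ a) δ (resolvent a) =
      (2 * Real.pi * Complex.I : ℂ) • (1 : A) := by
  have hlim : Tendsto (fun N : ℕ => (N : ℝ) * δ) atTop atTop :=
    tendsto_natCast_atTop_atTop.atTop_mul_const hδ
  -- On a large square of half-side `L`, the difference `R(z) - z⁻¹ = z⁻¹ a R(z)` has norm at most
  -- `L⁻¹ ‖a‖ ε`, as `R` tends to `0` at infinity. The perimeter `8 L` cancels `L⁻¹`, and `ε` is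
  -- arbitrary.
  have hbound : ∀ ε : ℝ, 0 < ε → ‖meshContourIntegral (spectrum ℂ a) δ (resolvent a) -
      (2 * Real.pi * Complex.I : ℂ) • (1 : A)‖ ≤ 8 * ‖a‖ * ε := by
    intro ε hε
    have hsmall : ∀ᶠ z in Bornology.cobounded ℂ, ‖resolvent a z‖ ≤ ε := by
      have := (spectrum.resolvent_tendsto_cobounded (𝕜 := ℂ) a).norm
      rw [norm_zero] at this
      exact (this.eventually_lt_const hε).mono fun z hz => hz.le
    have hoff : ∀ᶠ z in Bornology.cobounded ℂ, z ∉ spectrum ℂ a :=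
      Bornology.isBounded_def.1 (spectrum.isBounded a)
    obtain ⟨r, -, hr⟩ := (atTop_basis.cobounded_of_norm (E := ℂ)).eventually_iff.1
      (hsmall.and hoff)
    obtain ⟨N, hN, hN0, hNr⟩ := ((meshContourIntegral_eq_boxIntegral hδ (spectrum.isBounded a)
      (differentiableOn_resolvent a)).and ((hlim.eventually_gt_atTop 0).and
      (hlim.eventually_ge_atTop r))).exists
    set L : ℝ := N * δ
    have hL : ∀ z ∈ {z : ℂ | L ≤ ‖z‖}, ‖resolvent a z‖ ≤ ε ∧ z ∉ spectrum ℂ a := fun z hz =>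
      hr (hNr.trans hz)
    have hne : ∀ z ∈ {z : ℂ | L ≤ ‖z‖}, z ≠ 0 := fun z hz => norm_pos_iff.1 (hN0.trans_le hz)
    have hinv : ContinuousOn (fun z : ℂ => z⁻¹) {z : ℂ | L ≤ ‖z‖} := continuousOn_id.inv₀ hne
    have hinv1 : ContinuousOn (fun z : ℂ => z⁻¹ • (1 : A)) {z : ℂ | L ≤ ‖z‖} :=
      hinv.smul continuousOn_const
    have hR : ContinuousOn (resolvent a) {z : ℂ | L ≤ ‖z‖} :=
      (differentiableOn_resolvent a).continuousOn.mono fun z hz => (hL z hz).2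
    have hsub : boxIntegral L (resolvent a) - (2 * Real.pi * Complex.I : ℂ) • (1 : A) =
        boxIntegral L (fun z => resolvent a z - z⁻¹ • (1 : A)) := by
      rw [← boxIntegral_inv_smul hN0, ← boxChain_integral, ← boxChain_integral,
        ← boxChain_integral, PathChain.integral_sub _ hR hinv1]
    rw [hN, hsub]
    refine (norm_boxIntegral_le (M := L⁻¹ * (‖a‖ * ε)) hN0.le fun z hz => ?_).trans_eq ?_
    · have e : resolvent a z - z⁻¹ • (1 : A) = z⁻¹ • (a * resolvent a z) := by
        have h1 := sub_mul_resolvent (hL z hz).2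
        rw [sub_mul, ← Algebra.smul_def, sub_eq_iff_eq_add] at h1
        rw [sub_eq_iff_eq_add, ← smul_add, add_comm, ← h1, smul_smul,
          inv_mul_cancel₀ (hne z hz), one_smul]
      rw [e, norm_smul, norm_inv]
      refine mul_le_mul (inv_anti₀ hN0 hz) ?_ (norm_nonneg _) (inv_nonneg.2 hN0.le)
      exact (norm_mul_le _ _).trans
        (mul_le_mul_of_nonneg_left (hL z hz).1 (norm_nonneg _))
    · field_simp
  rw [← sub_eq_zero, ← norm_le_zero_iff]
  have hlim0 : Tendsto (fun ε : ℝ => 8 * ‖a‖ * ε) (𝓝[>] 0) (𝓝 0) := by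
    have : Continuous fun ε : ℝ => 8 * ‖a‖ * ε := by fun_prop
    simpa using (this.tendsto 0).mono_left nhdsWithin_le_nhds
  exact ge_of_tendsto hlim0 (eventually_mem_nhdsWithin.mono hbound)

end ResolventIntegral

/-! ### Algebraic properties of the mesh approximants -/

section Calculus

open Polynomial

variable {A : Type*} [NormedRing A] [NormedAlgebra ℂ A] [CompleteSpace A] {U : Set ℂ} {δ η : ℝ}
  {a : A} {f g : ℂ → ℂ}

/-- The approximant of mesh `δ` to the holomorphic functional calculus. -/
noncomputable def meshCalculus (δ : ℝ) (a : A) (f : ℂ → ℂ) : A :=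
  (2 * Real.pi * Complex.I : ℂ)⁻¹ •
    meshContourIntegral (spectrum ℂ a) δ fun z : ℂ => f z • resolvent a z

theorem continuousOn_smul_resolvent (hf : DifferentiableOn ℂ f U) :
    ContinuousOn (fun z => f z • resolvent a z) (U \ spectrum ℂ a) :=
  (hf.continuousOn.mono sdiff_subset).smul (continuousOn_resolvent a)

/-- The approximants as integrals over a chain of paths. -/
theorem MeshSubordinate.exists_pathChain_meshCalculus
    (h : MeshSubordinate (spectrum ℂ a) U δ) :
    ∃ C : PathChain (U \ spectrum ℂ a), (∀ f : ℂ → ℂ, meshCalculus δ a f =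
      (2 * Real.pi * Complex.I : ℂ)⁻¹ • C.integral fun z => f z • resolvent a z) ∧
      ∀ F : ℂ → A, DifferentiableOn ℂ F U → C.integral F = 0 := by
  obtain ⟨C, hC⟩ := h.exists_pathChain (E := A) (spectrum.isBounded a)
  refine ⟨C, fun f => by rw [meshCalculus, hC], fun F hF => ?_⟩
  rw [← hC, meshContourIntegral_eq_zero h (spectrum.isBounded a) hF]

theorem meshCalculus_one (hδ : 0 < δ) (a : A) : meshCalculus δ a (fun _ => 1) = 1 := by
  simp only [meshCalculus, one_smul]
  rw [meshContourIntegral_resolvent hδ, smul_smul, inv_mul_cancel₀ Complex.two_pi_I_ne_zero,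
    one_smul]

theorem meshCalculus_congr (h : MeshSubordinate (spectrum ℂ a) U δ) (hfg : EqOn f g U) :
    meshCalculus δ a f = meshCalculus δ a g := by
  obtain ⟨C, hC, -⟩ := h.exists_pathChain_meshCalculus
  rw [hC, hC]
  congr 1
  exact C.integral_congr fun z hz => by simp only [hfg hz.1]

theorem meshCalculus_add (h : MeshSubordinate (spectrum ℂ a) U δ) (hf : DifferentiableOn ℂ f U)
    (hg : DifferentiableOn ℂ g U) :
    meshCalculus δ a (fun z => f z + g z) = meshCalculus δ a f + meshCalculus δ a g := by
  obtain ⟨C, hC, -⟩ := h.exists_pathChain_meshCalculus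
  rw [hC, hC, hC, ← smul_add, ← C.integral_add (continuousOn_smul_resolvent hf)
    (continuousOn_smul_resolvent hg)]
  simp only [add_smul]

theorem meshCalculus_const_mul (h : MeshSubordinate (spectrum ℂ a) U δ) (c : ℂ) (f : ℂ → ℂ) :
    meshCalculus δ a (fun z => c * f z) = c • meshCalculus δ a f := by
  obtain ⟨C, hC, -⟩ := h.exists_pathChain_meshCalculus
  simp only [hC, mul_smul, C.integral_smul]
  rw [smul_comm]

theorem meshCalculus_sub (h : MeshSubordinate (spectrum ℂ a) U δ) (hf : DifferentiableOn ℂ f U)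
    (hg : DifferentiableOn ℂ g U) :
    meshCalculus δ a (fun z => f z - g z) = meshCalculus δ a f - meshCalculus δ a g := by
  have := meshCalculus_add h hf (hg.const_mul (-1))
  rw [meshCalculus_const_mul h, neg_one_smul] at this
  simpa [sub_eq_add_neg] using this

theorem meshCalculus_const (hδ : 0 < δ) (c : ℂ) :
    meshCalculus δ a (fun _ => c) = algebraMap ℂ A c := by
  -- Constants are entire, so any positive mesh is fine enough.
  have h : MeshSubordinate (spectrum ℂ a) univ δ := ⟨hδ, fun _ _ _ => subset_univ _⟩
  have := meshCalculus_const_mul h c (fun _ => 1)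
  simpa [meshCalculus_one hδ, Algebra.algebraMap_eq_smul_one] using this

/-- On the contour `z R(z) = 1 + a R(z)`, and the extra integrand `f(z) • 1` is holomorphic on `U`,
so Cauchy's theorem removes it. -/
theorem meshCalculus_id_mul (h : MeshSubordinate (spectrum ℂ a) U δ)
    (hf : DifferentiableOn ℂ f U) :
    meshCalculus δ a (fun z => z * f z) = a * meshCalculus δ a f := by
  obtain ⟨C, hC, hC0⟩ := h.exists_pathChain_meshCalculus
  have hc := continuousOn_smul_resolvent (a := a) hf
  have h1 := C.integral_clm_comp (ContinuousLinearMap.mul ℂ A a) hc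
  have h2 : EqOn (fun z => (z * f z) • resolvent a z) (fun z => f z • (1 : A) +
      ContinuousLinearMap.mul ℂ A a (f z • resolvent a z)) (U \ spectrum ℂ a) := by
    intro z hz
    have h3 := sub_mul_resolvent hz.2
    rw [sub_mul, ← Algebra.smul_def, sub_eq_iff_eq_add] at h3
    simp only [ContinuousLinearMap.mul_apply']
    rw [mul_comm, mul_smul, h3, smul_add, mul_smul_comm]
  have hfone : DifferentiableOn ℂ (fun z => f z • (1 : A)) U :=
    hf.smul (differentiableOn_const _)
  have hmul : ContinuousOn (fun z => ContinuousLinearMap.mul ℂ A a (f z • resolvent a z))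
      (U \ spectrum ℂ a) := (ContinuousLinearMap.mul ℂ A a).continuous.comp_continuousOn hc
  rw [hC, hC, C.integral_congr h2, C.integral_add (hfone.continuousOn.mono sdiff_subset) hmul,
    hC0 _ hfone, h1, zero_add,
    ContinuousLinearMap.mul_apply', mul_smul_comm]

theorem meshCalculus_eval_mul (h : MeshSubordinate (spectrum ℂ a) U δ) (p : ℂ[X])
    (hf : DifferentiableOn ℂ f U) :
    meshCalculus δ a (fun z => p.eval z * f z) = aeval a p * meshCalculus δ a f := by
  have hd : ∀ q : ℂ[X], DifferentiableOn ℂ (fun z => q.eval z * f z) U := fun q =>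
    q.differentiable.differentiableOn.mul hf
  induction p using Polynomial.induction_on with
  | C c => simp [meshCalculus_const_mul h, Algebra.smul_def]
  | add p q hp hq =>
    simp only [eval_add, add_mul, map_add]
    rw [meshCalculus_add h (hd p) (hd q), hp, hq]
  | monomial n c ih =>
    have e : (fun z => (C c * X ^ (n + 1)).eval z * f z) =
        fun z => z * ((C c * X ^ n).eval z * f z) := by
      ext z
      simp only [eval_mul, eval_C, eval_pow, eval_X]
      ring
    rw [e, meshCalculus_id_mul h (hd _), ih, ← mul_assoc]
    congr 1
    have : (C c * X ^ (n + 1) : ℂ[X]) = X * (C c * X ^ n) := by ring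
    rw [this, map_mul (aeval a) X, aeval_X]

/-- The resolvent times an approximant, through divided differences. -/
theorem meshCalculus_dslope (h : MeshSubordinate (spectrum ℂ a) U δ) (hU : IsOpen U)
    (hf : DifferentiableOn ℂ f U) {z : ℂ} (hz : z ∈ U \ spectrum ℂ a) :
    meshCalculus δ a (dslope f z) =
      f z • resolvent a z - resolvent a z * meshCalculus δ a f := by
  have hd : DifferentiableOn ℂ (dslope f z) U :=
    (Complex.differentiableOn_dslope (hU.mem_nhds hz.1)).2 hf
  have hd' : DifferentiableOn ℂ (fun w => w * dslope f z w) U := differentiableOn_id.mul hd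
  -- The calculus is applied in `w` to `(z - w) * dslope f z w = f z - f w`.
  have e : (algebraMap ℂ A z - a) * meshCalculus δ a (dslope f z) =
      algebraMap ℂ A (f z) - meshCalculus δ a f := by
    rw [sub_mul, ← meshCalculus_id_mul h hd, ← Algebra.smul_def, ← meshCalculus_const_mul h,
      ← meshCalculus_sub h (hd.const_mul z) hd',
      ← meshCalculus_const h.1 (f z), ← meshCalculus_sub h (differentiableOn_const _) hf]
    congr 1
    ext w
    have := sub_smul_dslope f z w
    rw [smul_eq_mul] at this
    linear_combination -this
  rw [← one_mul (meshCalculus δ a (dslope f z)), ← resolvent_mul_sub hz.2, mul_assoc, e, mul_sub,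
    ← Algebra.commutes, ← Algebra.smul_def]

/-- The approximants are multiplicative, also for contours with different meshes. -/
theorem meshCalculus_mul (hU : IsOpen U) (hδ : MeshSubordinate (spectrum ℂ a) U δ)
    (hη : MeshSubordinate (spectrum ℂ a) U η) (hf : DifferentiableOn ℂ f U)
    (hg : DifferentiableOn ℂ g U) :
    meshCalculus η a g * meshCalculus δ a f = meshCalculus η a (fun z => g z * f z) := by
  obtain ⟨C, hC, hC0⟩ := hδ.exists_pathChain_meshCalculus
  obtain ⟨D, hD, hD0⟩ := hη.exists_pathChain_meshCalculus
  set c : ℂ := (2 * Real.pi * Complex.I : ℂ)⁻¹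
  have hgR := continuousOn_smul_resolvent (a := a) hg
  have hgf : DifferentiableOn ℂ (fun z => g z * f z) U := hg.mul hf
  have hgfR := continuousOn_smul_resolvent (a := a) hgf
  set M := meshCalculus δ a f
  let L := (ContinuousLinearMap.mul ℂ A).flip M
  have h1 : EqOn (fun z => g z • meshCalculus δ a (dslope f z))
      (fun z => (g z * f z) • resolvent a z - L (g z • resolvent a z)) (U \ spectrum ℂ a) := by
    intro z hz
    simp only [L, ContinuousLinearMap.flip_apply, ContinuousLinearMap.mul_apply']
    rw [meshCalculus_dslope hδ hU hf hz, smul_sub, smul_smul, smul_mul_assoc]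
  -- After Fubini the inner integrand, for fixed `w`, is `g z * dslope f z w` times a constant
  -- element. It is holomorphic in `z` on `U`, so it integrates to zero. The divided difference has
  -- no singularity on the diagonal, so the two contours may meet or coincide.
  have h2 : D.integral (fun z => g z • meshCalculus δ a (dslope f z)) = 0 := by
    let F : ℂ → ℂ → A := fun z w => (c * (g z * dslope f z w)) • resolvent a w
    have hF : ContinuousOn (Function.uncurry F)
        ((U \ spectrum ℂ a) ×ˢ (U \ spectrum ℂ a)) := by
      refine ContinuousOn.smul (continuousOn_const.mul (ContinuousOn.mul ?_ ?_)) ?_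
      · exact (hg.continuousOn.mono sdiff_subset).comp continuousOn_fst fun p hp => hp.1
      · exact (hf.continuousOn_uncurry_dslope hU).mono
          (prod_mono sdiff_subset sdiff_subset)
      · exact (continuousOn_resolvent a).comp continuousOn_snd fun p hp => hp.2
    have e : (fun z => g z • meshCalculus δ a (dslope f z)) = fun z => C.integral (F z) := by
      ext z
      rw [hC, ← C.integral_smul, ← C.integral_smul]
      congr 1
      ext w
      simp only [F, smul_smul]
      congr 1
      ring
    rw [e, D.integral_integral_swap C hF]
    rw [C.integral_congr (G := fun _ => 0) fun w hw => ?_]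
    · exact hC0 _ (differentiableOn_const 0)
    · refine hD0 _ (DifferentiableOn.smul ((hg.mul ?_).const_mul c) (differentiableOn_const _))
      have := (Complex.differentiableOn_dslope (hU.mem_nhds hw.1)).2 hf
      exact this.congr fun z _ => dslope_comm f z w
  have hLR : ContinuousOn (fun z => L (g z • resolvent a z)) (U \ spectrum ℂ a) :=
    L.continuous.comp_continuousOn hgR
  rw [D.integral_congr h1, D.integral_sub hgfR hLR,
    D.integral_clm_comp L hgR, sub_eq_zero] at h2
  rw [hD, hD, h2, smul_mul_assoc]
  rfl

/-- This is multiplicativity with `g = 1`, whose approximant is `1` on any mesh. -/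
theorem meshCalculus_eq (hU : IsOpen U) (hδ : MeshSubordinate (spectrum ℂ a) U δ)
    (hη : MeshSubordinate (spectrum ℂ a) U η) (hf : DifferentiableOn ℂ f U) :
    meshCalculus δ a f = meshCalculus η a f := by
  have := meshCalculus_mul hU hδ hη hf (differentiableOn_const 1)
  simpa [meshCalculus_one hη.1] using this

/-- The approximants are eventually equal to the holomorphic functional calculus. -/
theorem meshCalculus_eq_holomorphicCalculus (hU : IsOpen U)
    (hδ : MeshSubordinate (spectrum ℂ a) U δ) (hf : DifferentiableOn ℂ f U)
    (hσ : spectrum ℂ a ⊆ U) :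
    meshCalculus δ a f = holomorphicCalculus f a := by
  refine (Tendsto.limUnder_eq (tendsto_const_nhds.congr' ?_)).symm
  filter_upwards [eventually_meshSubordinate (spectrum.isCompact a) hU hσ] with η hη
  exact meshCalculus_eq hU hδ hη hf

end Calculus

/-! ### The holomorphic calculus and the factorization of `f(a) - μ` -/

section SpectralMapping

variable {A : Type*} [NormedRing A] [NormedAlgebra ℂ A] [CompleteSpace A] {U : Set ℂ}
  {a : A} {f g : ℂ → ℂ}

open Polynomial

theorem holomorphicCalculus_mul (hU : IsOpen U) (hσ : spectrum ℂ a ⊆ U)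
    (hf : DifferentiableOn ℂ f U) (hg : DifferentiableOn ℂ g U) :
    holomorphicCalculus (fun z => f z * g z) a =
      holomorphicCalculus f a * holomorphicCalculus g a := by
  obtain ⟨δ, hδ⟩ := (eventually_meshSubordinate (spectrum.isCompact a) hU hσ).exists
  have hfg : DifferentiableOn ℂ (fun z => f z * g z) U := hf.mul hg
  rw [← meshCalculus_eq_holomorphicCalculus hU hδ hf hσ,
    ← meshCalculus_eq_holomorphicCalculus hU hδ hg hσ,
    ← meshCalculus_eq_holomorphicCalculus hU hδ hfg hσ, meshCalculus_mul hU hδ hδ hg hf]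

theorem holomorphicCalculus_sub_const (hU : IsOpen U) (hσ : spectrum ℂ a ⊆ U)
    (hf : DifferentiableOn ℂ f U) (c : ℂ) :
    holomorphicCalculus (fun z => f z - c) a = holomorphicCalculus f a - algebraMap ℂ A c := by
  obtain ⟨δ, hδ⟩ := (eventually_meshSubordinate (spectrum.isCompact a) hU hσ).exists
  rw [← meshCalculus_eq_holomorphicCalculus hU hδ hf hσ,
    ← meshCalculus_eq_holomorphicCalculus hU hδ (hf.sub_const c) hσ,
    meshCalculus_sub hδ hf (differentiableOn_const c), meshCalculus_const hδ.1]

theorem holomorphicCalculus_congr (hU : IsOpen U) (hσ : spectrum ℂ a ⊆ U)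
    (hf : DifferentiableOn ℂ f U) (hfg : EqOn f g U) :
    holomorphicCalculus f a = holomorphicCalculus g a := by
  obtain ⟨δ, hδ⟩ := (eventually_meshSubordinate (spectrum.isCompact a) hU hσ).exists
  rw [← meshCalculus_eq_holomorphicCalculus hU hδ hf hσ,
    ← meshCalculus_eq_holomorphicCalculus hU hδ (hf.congr hfg.symm) hσ, meshCalculus_congr hδ hfg]

theorem holomorphicCalculus_eval (a : A) (p : ℂ[X]) :
    holomorphicCalculus (fun z => p.eval z) a = aeval a p := by
  obtain ⟨δ, hδ⟩ := (eventually_meshSubordinate (spectrum.isCompact a) isOpen_univ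
    (subset_univ _)).exists
  rw [← meshCalculus_eq_holomorphicCalculus isOpen_univ hδ p.differentiable.differentiableOn
    (subset_univ _)]
  simpa [meshCalculus_one hδ.1] using meshCalculus_eval_mul hδ p (differentiableOn_const 1)

/-- A function without zeros on the spectrum gives a unit. -/
theorem isUnit_holomorphicCalculus (hU : IsOpen U) (hσ : spectrum ℂ a ⊆ U)
    (hf : DifferentiableOn ℂ f U) (h0 : ∀ z ∈ spectrum ℂ a, f z ≠ 0) :
    IsUnit (holomorphicCalculus f a) := by
  -- `V` is still a neighbourhood of the spectrum, and `1 / f` is holomorphic on it.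
  set V := U ∩ f ⁻¹' {0}ᶜ
  have hV : IsOpen V := hf.continuousOn.isOpen_inter_preimage hU isOpen_compl_singleton
  have hσV : spectrum ℂ a ⊆ V := fun z hz => ⟨hσ hz, h0 z hz⟩
  have hfV : DifferentiableOn ℂ f V := hf.mono inter_subset_left
  have hinv : DifferentiableOn ℂ (fun z => (f z)⁻¹) V := hfV.inv fun z hz => hz.2
  have hone : holomorphicCalculus (fun _ => 1) a = 1 := by
    simpa using holomorphicCalculus_eval a 1
  refine isUnit_iff_exists.2 ⟨holomorphicCalculus (fun z => (f z)⁻¹) a, ?_, ?_⟩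
  · rw [← holomorphicCalculus_mul hV hσV hfV hinv, ← hone]
    exact holomorphicCalculus_congr hV hσV (hfV.mul hinv) fun z hz => mul_inv_cancel₀ hz.2
  · rw [← holomorphicCalculus_mul hV hσV hinv hfV, ← hone]
    exact holomorphicCalculus_congr hV hσV (hinv.mul hfV) fun z hz => inv_mul_cancel₀ hz.2

/-- `f(a) - μ` is the product of a polynomial in `a`, whose roots are the zeros of `f - μ` in the
spectrum, and a unit that commutes with it. -/
theorem exists_holomorphicCalculus_sub_eq (hU : IsOpen U) (hσ : spectrum ℂ a ⊆ U)
    (hf : AnalyticOnNhd ℂ f U) (μ : ℂ)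
    (hne : ∀ z ∈ spectrum ℂ a, ¬ ∀ᶠ w in 𝓝 z, f w - μ = 0) :
    ∃ (s : Finset ℂ) (n : ℂ → ℕ) (u : A), (∀ z, z ∈ s ↔ z ∈ spectrum ℂ a ∧ f z = μ) ∧
      (∀ z ∈ s, n z ≠ 0) ∧ IsUnit u ∧ Commute (aeval a (∏ z ∈ s, (X - C z) ^ n z)) u ∧
      holomorphicCalculus f a - algebraMap ℂ A μ = aeval a (∏ z ∈ s, (X - C z) ^ n z) * u := by
  have hfμ : AnalyticOnNhd ℂ (fun w => f w - μ) U := fun z hz => (hf z hz).sub analyticAt_const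
  have hfin := hfμ.finite_zeros_of_isCompact (spectrum.isCompact a) hσ hne
  have hmem : ∀ z, z ∈ hfin.toFinset ↔ z ∈ spectrum ℂ a ∧ f z = μ := fun z => by
    simp [sub_eq_zero]
  obtain ⟨n, g, hg, hgs, hfg⟩ := hfμ.exists_eq_prod_pow_mul hU hfin.toFinset
    (fun z hz => hσ ((hmem z).1 hz).1) (fun z hz => hne z ((hmem z).1 hz).1)
  set p : ℂ[X] := ∏ z ∈ hfin.toFinset, (X - C z) ^ n z
  have hp : ∀ w ∈ U, f w - μ = p.eval w * g w := fun w hw => by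
    rw [hfg w hw]
    simp [p, eval_prod]
  have hgU := hg.differentiableOn
  have hpU : DifferentiableOn ℂ (fun z => p.eval z) U := p.differentiable.differentiableOn
  have hpg : holomorphicCalculus (fun z => p.eval z * g z) a =
      aeval a p * holomorphicCalculus g a := by
    rw [holomorphicCalculus_mul hU hσ hpU hgU, holomorphicCalculus_eval]
  -- The same element computed in the other order yields the commutation.
  have hgp : holomorphicCalculus (fun z => p.eval z * g z) a =
      holomorphicCalculus g a * aeval a p := by
    simp only [mul_comm (eval _ p)]
    rw [holomorphicCalculus_mul hU hσ hgU hpU, holomorphicCalculus_eval]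
  refine ⟨hfin.toFinset, n, holomorphicCalculus g a, hmem, ?_, ?_, hpg.symm.trans hgp, ?_⟩
  -- Since `f z - μ = 0` and `g z ≠ 0`, some factor of the product vanishes at `z`. It can only be
  -- the one belonging to `z`, and that one would be `1` if its exponent were `0`.
  · intro z hz hn
    obtain ⟨hzσ, hzμ⟩ := (hmem z).1 hz
    have h1 := hfg z (hσ hzσ)
    rw [hzμ, sub_self, eq_comm, mul_eq_zero, Finset.prod_eq_zero_iff] at h1
    rcases h1 with ⟨w, -, hw⟩ | h1
    · have hzw : z = w := sub_eq_zero.1 (by_contra fun h => pow_ne_zero _ h hw)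
      rw [← hzw, hn, pow_zero] at hw
      exact one_ne_zero hw
    · exact hgs z hz h1
  · refine isUnit_holomorphicCalculus hU hσ hgU fun z hz h0 => ?_
    by_cases hzs : z ∈ hfin.toFinset
    · exact hgs z hzs h0
    · refine hzs ((hmem z).2 ⟨hz, ?_⟩)
      rw [← sub_eq_zero, hp z (hσ hz), h0, mul_zero]
  · rw [← hpg, ← holomorphicCalculus_sub_const hU hσ hf.differentiableOn]
    exact holomorphicCalculus_congr hU hσ hfμ.differentiableOn hp

end SpectralMapping

/-! ### The spectral mapping theorem -/

theorem mainTheorem4 {A : Type*} [NormedRing A] [NormedAlgebra ℂ A] [CompleteSpace A]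
    (J : Ideal A) [J.IsTwoSided] (a : A) (f : ℂ → ℂ) (U : Set ℂ)
    (hU : IsOpen U) (hσU : spectrum ℂ a ⊆ U) (hf : AnalyticOnNhd ℂ f U)
    (hnc : ∀ z ∈ spectrum ℂ a, ∀ V : Set ℂ, IsOpen V →
      connectedComponentIn (spectrum ℂ a) z ⊆ V → ¬ ∃ c : ℂ, ∀ w ∈ V, f w = c) :
    f '' bFredholmSpectrum J a = bFredholmSpectrum J (holomorphicCalculus f a) ∧
      f '' fredholmSpectrum J a = fredholmSpectrum J (holomorphicCalculus f a) := by
  -- Working through `ℂ[X]` places the Bezout identities in a commutative ring.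
  let φ : Polynomial ℂ →+* A ⧸ J := (Ideal.Quotient.mk J).comp (Polynomial.aeval a).toRingHom
  have hφ : ∀ z, φ (Polynomial.X - Polynomial.C z) =
      Ideal.Quotient.mk J (a - algebraMap ℂ A z) := fun z => by simp [φ]
  have hunit : ∀ z, z ∉ spectrum ℂ a → IsUnit (φ (Polynomial.X - Polynomial.C z)) := by
    intro z hz
    rw [hφ]
    have := (not_not.1 hz : IsUnit (algebraMap ℂ A z - a)).neg
    rw [neg_sub] at this
    exact this.map _
  have hcop : ∀ s : Set ℂ, s.Pairwise fun z w =>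
      IsCoprime (Polynomial.X - Polynomial.C z) (Polynomial.X - Polynomial.C w) :=
    fun s z _ w _ hzw => Polynomial.isCoprime_X_sub_C_of_isUnit_sub (sub_ne_zero.2 hzw).isUnit
  have key : ∀ μ : ℂ, ∃ (s : Finset ℂ) (n : ℂ → ℕ) (u : A ⧸ J),
      (∀ z, z ∈ s ↔ z ∈ spectrum ℂ a ∧ f z = μ) ∧ (∀ z ∈ s, n z ≠ 0) ∧ IsUnit u ∧
      Commute (φ (∏ z ∈ s, (Polynomial.X - Polynomial.C z) ^ n z)) u ∧
      Ideal.Quotient.mk J (holomorphicCalculus f a - algebraMap ℂ A μ) =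
        φ (∏ z ∈ s, (Polynomial.X - Polynomial.C z) ^ n z) * u := by
    intro μ
    obtain ⟨s, n, u, h1, h2, h3, h4, h5⟩ := exists_holomorphicCalculus_sub_eq hU hσU hf μ
      fun z hz => hf.not_eventually_eq_of_connectedComponentIn hσU hnc μ hz
    exact ⟨s, n, Ideal.Quotient.mk J u, h1, h2, h3.map _, h4.map (Ideal.Quotient.mk J), by
      rw [h5, map_mul]; rfl⟩
  constructor
  · ext μ
    obtain ⟨s, n, u, h1, h2, h3, h4, h5⟩ := key μ
    simp only [bFredholmSpectrum, IsBFredholmElement, mem_image, mem_ofPred_eq, h5,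
      h3.isDrazinInvertible_mul_iff h4, isDrazinInvertible_map_prod_pow_iff φ s _ n h2 (hcop _),
      ← hφ]
    push Not
    refine exists_congr fun z => ⟨fun ⟨hz, hzμ⟩ => ⟨(h1 z).2 ⟨?_, hzμ⟩, hz⟩,
      fun ⟨hz, hz'⟩ => ⟨hz', ((h1 z).1 hz).2⟩⟩
    -- `s` records only the preimages of `μ` inside `σ(a)`; a preimage outside would give a unit
    -- modulo `J`, which is Drazin invertible.
    by_contra hzσ
    exact hz (hunit z hzσ).isDrazinInvertible
  · ext μ
    obtain ⟨s, n, u, h1, h2, h3, h4, h5⟩ := key μ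
    simp only [fredholmSpectrum, IsFredholmElement, mem_image, mem_ofPred_eq, h5,
      h4.isUnit_mul_iff, h3, and_true, isUnit_map_prod_pow_iff φ s _ n h2, ← hφ]
    push Not
    refine exists_congr fun z => ⟨fun ⟨hz, hzμ⟩ => ⟨(h1 z).2 ⟨?_, hzμ⟩, hz⟩,
      fun ⟨hz, hz'⟩ => ⟨hz', ((h1 z).1 hz).2⟩⟩
    by_contra hzσ
    exact hz (hunit z hzσ)
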